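/- Conventions. Operations have arity at least one, and $k$ ranges over the positive integers. A $k$-sorted Boolean operation of arity $n$ is a $k$-tuple $(h_1,\dots,h_k)$ of functions $h_i:\{0,1\}^n\to\{0,1\}$. A relation of arity $m\ge 1$ on the $k$-sorted Boolean set is a set $R\subseteq\{0,1\}^m$ together with a type $(i_1,\dots,i_m)\in\{1,\dots,k\}^m$; it is preserved by $(h_1,\dots,h_k)$ if applying $h_{i_j}$ in the $j$-th coordinate to any $n$ tuples of $R$ always gives a tuple of $R$. $\mathrm{Pol}(\Gamma)$ is the set of all $k$-sorted Boolean operations that preserve all relations in $\Gamma$. A minion $\mathcal M$ consists of nonempty sets $\mathcal M^{(n)}$, $n\ge 1$, and maps $\mathcal M^{(\alpha)}:\mathcal M^{(n)}\to\mathcal M^{(m)}$ for all $\alpha:\{1,\dots,n\}\to\{1,\dots,m\}$, with $\mathcal M^{(\mathrm{id})}=\mathrm{id}$ and $\mathcal M^{(\alpha\circ\beta)}=\mathcal M^{(\alpha)}\circ\mathcal M^{(\beta)}$. A minion homomorphism $\mathcal M\to\mathcal N$ is a family of maps $\mathcal M^{(n)}\to\mathcal N^{(n)}$ that commutes with all the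 maps $\mathcal M^{(\alpha)}$, $\mathcal N^{(\alpha)}$. Write $\mathcal M\le\mathcal N$ if there is a minion homomorphism $\mathcal M\to\mathcal N$, and $\mathcal M\sim\mathcal N$ if $\mathcal M\le\mathcal N\le\mathcal M$. A minion is a minion core if each of its endomorphisms is an automorphism. A nonempty set of multisorted operations that is closed under the minors $f^{(\alpha)}(a_1,\dots,a_m)=f(a_{\alpha(1)},\dots,a_{\alpha(n)})$ (taken in every sort) is regarded as a minion. For $f,g:\{0,1\}^n\to\{0,1\}$ write $f\le g$ for the pointwise order, $f\triangleleft g$ if $f(\mathbf a)\le g(\mathbf b)$ whenever $\mathbf a\le\mathbf b$ coordinatewise, and $f^d(\mathbf a)=1-f(\overline{\mathbf a})$, where $\overline{\mathbf a}$ is the coordinatewise negation. Let $\mathcal I_k$ be the set of all $k$-sorted Boolean operations with $h_i(a,\dots,a)=a$ for all $i$ and all $a\in\{0,1\}$. Let $\mathcal T$ be the clone of all operations on a one-element set, and let $$\begin{aligned} \mathcal A_k&=\{(h_1,\dots,h_k)\in\mathcal I_k: h_1\triangleleft h_2\triangleleft\dots\triangleleft h_k\le h_k^d\},\\ \mathcal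 B_k&=\{(h_1,\dots,h_k)\in\mathcal I_k: h_1\triangleleft h_2\triangleleft\dots\triangleleft h_k\triangleleft h_k^d\},\\ \mathcal C_{k+1}&=\{(h_1,\dots,h_{k+1})\in\mathcal I_{k+1}: h_1\triangleleft\dots\triangleleft h_{k}\le h_{k+1}=h_{k+1}^d,\ h_{k}\triangleleft h_{k}^d\},\\ \mathcal D_k&=\{(h_1,\dots,h_k)\in\mathcal I_k: h_1\triangleleft h_2\triangleleft\dots\triangleleft h_k=h_k^d\},\\ \mathcal B_\infty&=\{(h)\in\mathcal I_1: h\triangleleft h\triangleleft h^d\},\\ \mathcal C_\infty&=\{(h_1,h_2)\in\mathcal I_2: h_1\triangleleft h_1\triangleleft h_2=h_2^d\},\\ \mathcal D_\infty&=\{(h)\in\mathcal I_1: h\triangleleft h=h^d\}. \end{aligned}$$ Theorem. Let $\Gamma$ be a set of at most binary relations on a $k$-sorted Boolean set, for some $k\ge 1$. Then $\mathrm{Pol}(\Gamma)$ is $\sim$-equivalent to exactly one of the minions $\mathcal T$, $\mathcal A_k$, $\mathcal B_k$, $\mathcal C_{k+1}$, $\mathcal D_k$ ($k\ge 1$), $\mathcal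 B_\infty$, $\mathcal C_\infty$, $\mathcal D_\infty$. All of these minions are minion cores. The relation $\le$ on the list is exactly the reflexive and transitive closure of $$\mathcal D_\infty\le\mathcal C_\infty\le\mathcal B_\infty,\qquad \mathcal A_1\le\mathcal T,$$ $$\mathcal B_\infty\le\mathcal B_k,\qquad \mathcal A_{k+1}\le\mathcal B_k\le\mathcal A_k,\qquad \mathcal C_\infty\le\mathcal C_{k+1},\qquad \mathcal D_{k+1}\le\mathcal C_{k+1}\le\mathcal D_k,\qquad \mathcal C_{k+1}\le\mathcal B_k,\qquad \mathcal D_k\le\mathcal A_k\qquad(k\ge 1).$$ Conversely, for every minion $\mathcal M$ on the list there are $k\ge 1$ and a set $\Gamma$ of at most binary relations on the $k$-sorted Boolean set with $\mathcal M\sim\mathrm{Pol}(\Gamma)$. -/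

import Mathlib

namespace MultisortedBoolean

universe u v w

/-! ### Abstract minions -/

/-- An (abstract) minion: a nonempty set `obj n` for every positive integer `n`, with a minor map
`obj n → obj m` for every function `α : [n] → [m]`, functorially in `α`. -/
structure Minion where
  obj : ℕ+ → Type u
  nonempty : ∀ n, Nonempty (obj n)
  map : ∀ {n m : ℕ+}, (Fin n → Fin m) → obj n → obj m
  map_id : ∀ {n : ℕ+} (x : obj n), map (id : Fin n → Fin n) x = x
  map_comp : ∀ {n m p : ℕ+} (α : Fin m → Fin p) (β : Fin n → Fin m) (x : obj n),
    map (α ∘ β) x = map α (map β x)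

namespace Minion

/-- A minion homomorphism: a family of functions that preserves taking minors. -/
@[ext]
structure Hom (M : Minion.{u}) (N : Minion.{v}) where
  app : ∀ n : ℕ+, M.obj n → N.obj n
  app_map : ∀ {n m : ℕ+} (α : Fin n → Fin m) (x : M.obj n),
    app m (M.map α x) = N.map α (app n x)

/-- The identity homomorphism. -/
def Hom.id (M : Minion.{u}) : Hom M M where
  app _ x := x
  app_map _ _ := rfl

/-- Composition of homomorphisms, `ζ` after `ξ`. -/
def Hom.comp {M : Minion.{u}} {N : Minion.{v}} {P : Minion.{w}} (ζ : Hom N P) (ξ : Hom M N) :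
    Hom M P where
  app n x := ζ.app n (ξ.app n x)
  app_map α x := by rw [ξ.app_map, ζ.app_map]

/-- `M ≤ N`: there is a minion homomorphism from `M` to `N`. -/
def HomLE (M : Minion.{u}) (N : Minion.{v}) : Prop := Nonempty (Hom M N)

/-- `M ∼ N`: there are minion homomorphisms in both directions. -/
def Equivalent (M : Minion.{u}) (N : Minion.{v}) : Prop := HomLE M N ∧ HomLE N M

/-- A minion core: every endomorphism is an automorphism. -/
def IsCore (M : Minion.{u}) : Prop :=
  ∀ ξ : Hom M M, ∃ ζ : Hom M M, ζ.comp ξ = Hom.id M ∧ ξ.comp ζ = Hom.id M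

end Minion

/-! ### Multisorted operations, relations and polymorphisms -/

/-- An `n`-ary operation from the `k`-sorted set `A` to the `k`-sorted set `B`:
a `k`-tuple of functions `A i ^ n → B i`. -/
abbrev Op {k : ℕ} (A : Fin k → Type u) (B : Fin k → Type v) (n : ℕ+) :=
  ∀ i : Fin k, (Fin n → A i) → B i

section

variable {k : ℕ} {A : Fin k → Type u} {B : Fin k → Type v}

/-- The minor of `f` along `α : [n] → [m]`: `(a_1, …, a_m) ↦ f (a_{α 1}, …, a_{α n})`,
in every sort. -/
def Op.minor {n m : ℕ+} (f : Op A B n) (α : Fin n → Fin m) : Op A B m :=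
  fun i a => f i (a ∘ α)

/-- The `n`-ary projection to coordinate `j` on a multisorted set. -/
def Op.proj (A : Fin k → Type u) (n : ℕ+) (j : Fin n) : Op A A n := fun _ a => a j

/-- An operation is idempotent if all its components are. -/
def Op.Idempotent {n : ℕ+} (f : Op A A n) : Prop :=
  ∀ (i : Fin k) (a : A i), f i (fun _ => a) = a

end

/-- A function minion on `(A, B)`: a nonempty set of operations from `A` to `B`, given by its
`n`-ary parts, that is closed under taking minors. -/
structure FunctionMinion {k : ℕ} (A : Fin k → Type u) (B : Fin k → Type v) where
  ops : ∀ n : ℕ+, Set (Op A B n)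
  nonempty : ∃ n, (ops n).Nonempty
  minor_mem : ∀ {n m : ℕ+} (f : Op A B n) (α : Fin n → Fin m), f ∈ ops n → f.minor α ∈ ops m

/-- A function minion, seen as an abstract minion. -/
def FunctionMinion.toMinion {k : ℕ} {A : Fin k → Type u} {B : Fin k → Type v}
    (M : FunctionMinion A B) : Minion.{max u v} where
  obj n := M.ops n
  nonempty m := by
    obtain ⟨n, f, hf⟩ := M.nonempty
    exact ⟨⟨f.minor (fun _ => ⟨0, m.pos⟩), M.minor_mem f _ hf⟩⟩
  map α f := ⟨f.1.minor α, M.minor_mem f.1 α f.2⟩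
  map_id _ := rfl
  map_comp _ _ _ := rfl

/-- A relation on a `k`-sorted set `A`, of positive arity. Its type (the sequence of the sorts of
its coordinates) is part of the data. -/
structure SortedRelation {k : ℕ} (A : Fin k → Type u) where
  arity : ℕ+
  sort : Fin arity → Fin k
  tuples : Set (∀ j : Fin arity, A (sort j))

/-- `f` preserves `R`: applying `f` component-wise to `n` tuples of `R` gives a tuple of `R`. -/
def Op.Preserves {k : ℕ} {A : Fin k → Type u} {n : ℕ+} (f : Op A A n) (R : SortedRelation A) : Prop :=
  ∀ r : Fin n → ∀ j : Fin R.arity, A (R.sort j),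
    (∀ i, r i ∈ R.tuples) → (fun j => f (R.sort j) (fun i => r i j)) ∈ R.tuples

/-- `Pol Γ`: all the operations that preserve every relation in `Γ`. -/
def Pol {k : ℕ} {A : Fin k → Type u} (Γ : Set (SortedRelation A)) : FunctionMinion A A where
  ops _ := {f | ∀ R ∈ Γ, f.Preserves R}
  nonempty := ⟨1, Op.proj A 1 0, fun _ _ _ hr => hr 0⟩
  minor_mem _ α hf R hR r hr := hf R hR (fun i => r (α i)) (fun i => hr (α i))

/-! ### Boolean operations -/

/-- The `k`-sorted Boolean set. The values `0` and `1` are `false` and `true`. -/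
abbrev boolSorts (k : ℕ) : Fin k → Type := fun _ => Bool

/-- `n`-ary Boolean operations, ordered pointwise. -/
abbrev BoolOp (n : ℕ+) := (Fin n → Bool) → Bool

/-- `f ◁ g`: `f a ≤ g b` whenever `a ≤ b` coordinatewise. -/
def Tri {n : ℕ+} (f g : BoolOp n) : Prop := ∀ a b : Fin n → Bool, a ≤ b → f a ≤ g b

/-- The dual operation: `dual f a = 1 - f (1 - a)`. -/
def dual {n : ℕ+} (f : BoolOp n) : BoolOp n := fun a => !(f fun i => !(a i))

/-! ### The minions on the list

A `k`-tuple `(h_1, …, h_k)` is indexed by `Fin k`, so that `h_i` has the index `i - 1`. -/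

theorem tri_proj {n : ℕ+} (j : Fin n) : Tri (fun a => a j) (fun a => a j) :=
  fun _ _ hab => hab j

theorem dual_proj {n : ℕ+} (j : Fin n) : dual (fun a => a j) = fun a => a j := by
  funext a
  simp [dual]

theorem tri_minor {n m : ℕ+} {f g : BoolOp n} (α : Fin n → Fin m) (h : Tri f g) :
    Tri (fun a : Fin m → Bool => f (a ∘ α)) (fun a => g (a ∘ α)) :=
  fun a b hab => h (a ∘ α) (b ∘ α) fun i => hab (α i)

theorem le_minor {n m : ℕ+} {f g : BoolOp n} (α : Fin n → Fin m) (h : f ≤ g) :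
    (fun a : Fin m → Bool => f (a ∘ α)) ≤ (fun a => g (a ∘ α)) :=
  fun a => h (a ∘ α)

theorem eq_minor {n m : ℕ+} {f g : BoolOp n} (α : Fin n → Fin m) (h : f = g) :
    (fun a : Fin m → Bool => f (a ∘ α)) = (fun a => g (a ∘ α)) := by
  rw [h]

/-- `T`: the clone of all operations on the one-sorted set with a single element. -/
def minionT : FunctionMinion (fun _ : Fin 1 => Unit) (fun _ : Fin 1 => Unit) where
  ops _ := Set.univ
  nonempty := ⟨1, fun _ _ => (), trivial⟩
  minor_mem _ _ _ := trivial

/-- `A_k`: idempotent, `h_1 ◁ h_2 ◁ … ◁ h_k ≤ h_k^d`. -/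
def minionA (k : ℕ+) : FunctionMinion (boolSorts k) (boolSorts k) where
  ops _ := {h | h.Idempotent ∧
    (∀ i j : Fin k, (i : ℕ) + 1 = j → Tri (h i) (h j)) ∧
    (∀ i : Fin k, (i : ℕ) + 1 = k → h i ≤ dual (h i))}
  nonempty := ⟨1, Op.proj _ 1 0, fun _ _ => rfl, fun _ _ _ => tri_proj 0,
    fun _ _ => (dual_proj (n := 1) 0).ge⟩
  minor_mem _ α h := ⟨fun i a => h.1 i a, fun i j hij => tri_minor α (h.2.1 i j hij),
    fun i hi => le_minor α (h.2.2 i hi)⟩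

/-- `B_k`: idempotent, `h_1 ◁ h_2 ◁ … ◁ h_k ◁ h_k^d`. -/
def minionB (k : ℕ+) : FunctionMinion (boolSorts k) (boolSorts k) where
  ops _ := {h | h.Idempotent ∧
    (∀ i j : Fin k, (i : ℕ) + 1 = j → Tri (h i) (h j)) ∧
    (∀ i : Fin k, (i : ℕ) + 1 = k → Tri (h i) (dual (h i)))}
  nonempty := ⟨1, Op.proj _ 1 0, fun _ _ => rfl, fun _ _ _ => tri_proj 0,
    fun _ _ => (dual_proj (n := 1) 0).symm ▸ tri_proj (n := 1) 0⟩
  minor_mem _ α h := ⟨fun i a => h.1 i a, fun i j hij => tri_minor α (h.2.1 i j hij),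
    fun i hi => tri_minor α (h.2.2 i hi)⟩

/-- `C_k`: idempotent, `h_1 ◁ … ◁ h_{k-1} ≤ h_k = h_k^d` and `h_{k-1} ◁ h_{k-1}^d`.
(For `k = 1` only `h_1 = h_1^d` remains.) -/
def minionC (k : ℕ+) : FunctionMinion (boolSorts k) (boolSorts k) where
  ops _ := {h | h.Idempotent ∧
    (∀ i j : Fin k, (i : ℕ) + 1 = j → (j : ℕ) + 1 < k → Tri (h i) (h j)) ∧
    (∀ i j : Fin k, (i : ℕ) + 1 = j → (j : ℕ) + 1 = k → h i ≤ h j) ∧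
    (∀ i : Fin k, (i : ℕ) + 1 = k → h i = dual (h i)) ∧
    (∀ i : Fin k, (i : ℕ) + 2 = k → Tri (h i) (dual (h i)))}
  nonempty := ⟨1, Op.proj _ 1 0, fun _ _ => rfl, fun _ _ _ _ => tri_proj 0,
    fun _ _ _ _ => le_rfl, fun _ _ => (dual_proj (n := 1) 0).symm,
    fun _ _ => (dual_proj (n := 1) 0).symm ▸ tri_proj (n := 1) 0⟩
  minor_mem _ α h := ⟨fun i a => h.1 i a, fun i j hij hj => tri_minor α (h.2.1 i j hij hj),
    fun i j hij hj => le_minor α (h.2.2.1 i j hij hj), fun i hi => eq_minor α (h.2.2.2.1 i hi),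
    fun i hi => tri_minor α (h.2.2.2.2 i hi)⟩

/-- `D_k`: idempotent, `h_1 ◁ h_2 ◁ … ◁ h_k = h_k^d`. -/
def minionD (k : ℕ+) : FunctionMinion (boolSorts k) (boolSorts k) where
  ops _ := {h | h.Idempotent ∧
    (∀ i j : Fin k, (i : ℕ) + 1 = j → Tri (h i) (h j)) ∧
    (∀ i : Fin k, (i : ℕ) + 1 = k → h i = dual (h i))}
  nonempty := ⟨1, Op.proj _ 1 0, fun _ _ => rfl, fun _ _ _ => tri_proj 0,
    fun _ _ => (dual_proj (n := 1) 0).symm⟩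
  minor_mem _ α h := ⟨fun i a => h.1 i a, fun i j hij => tri_minor α (h.2.1 i j hij),
    fun i hi => eq_minor α (h.2.2 i hi)⟩

/-- `B_∞`: one sort, idempotent, `h ◁ h ◁ h^d`. -/
def minionBinf : FunctionMinion (boolSorts 1) (boolSorts 1) where
  ops _ := {h | h.Idempotent ∧ Tri (h 0) (h 0) ∧ Tri (h 0) (dual (h 0))}
  nonempty := ⟨1, Op.proj _ 1 0, fun _ _ => rfl, tri_proj 0,
    (dual_proj (n := 1) 0).symm ▸ tri_proj (n := 1) 0⟩
  minor_mem _ α h := ⟨fun i a => h.1 i a, tri_minor α h.2.1, tri_minor α h.2.2⟩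

/-- `C_∞`: two sorts, idempotent, `h_1 ◁ h_1 ◁ h_2 = h_2^d`. -/
def minionCinf : FunctionMinion (boolSorts 2) (boolSorts 2) where
  ops _ := {h | h.Idempotent ∧ Tri (h 0) (h 0) ∧ Tri (h 0) (h 1) ∧ h 1 = dual (h 1)}
  nonempty := ⟨1, Op.proj _ 1 0, fun _ _ => rfl, tri_proj 0, tri_proj 0,
    (dual_proj (n := 1) 0).symm⟩
  minor_mem _ α h := ⟨fun i a => h.1 i a, tri_minor α h.2.1, tri_minor α h.2.2.1,
    eq_minor α h.2.2.2⟩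

/-- `D_∞`: one sort, idempotent, `h ◁ h = h^d`. -/
def minionDinf : FunctionMinion (boolSorts 1) (boolSorts 1) where
  ops _ := {h | h.Idempotent ∧ Tri (h 0) (h 0) ∧ h 0 = dual (h 0)}
  nonempty := ⟨1, Op.proj _ 1 0, fun _ _ => rfl, tri_proj 0, (dual_proj (n := 1) 0).symm⟩
  minor_mem _ α h := ⟨fun i a => h.1 i a, tri_minor α h.2.1, eq_minor α h.2.2⟩

/-- The entries of the list `T`, `A_k`, `B_k`, `C_{k+1}`, `D_k` (`k ≥ 1`), `B_∞`, `C_∞`, `D_∞`.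
The entry `C_{k+1}` is written `C k`. -/
inductive ListIndex
  | T
  | A (k : ℕ+)
  | B (k : ℕ+)
  | C (k : ℕ+)
  | D (k : ℕ+)
  | Binf
  | Cinf
  | Dinf

/-- The minion that an entry of the list stands for. -/
def listMinion : ListIndex → Minion.{0}
  | .T => minionT.toMinion
  | .A k => (minionA k).toMinion
  | .B k => (minionB k).toMinion
  | .C k => (minionC (k + 1)).toMinion
  | .D k => (minionD k).toMinion
  | .Binf => minionBinf.toMinion
  | .Cinf => minionCinf.toMinion
  | .Dinf => minionDinf.toMinion

/-- The edges of the diagram of the order on the list, from the smaller to the larger entry. -/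
inductive Edge : ListIndex → ListIndex → Prop
  /-- `D_∞ < C_∞` -/
  | Dinf_Cinf : Edge .Dinf .Cinf
  /-- `C_∞ < B_∞` -/
  | Cinf_Binf : Edge .Cinf .Binf
  /-- `B_∞ < B_k` -/
  | Binf_B (k : ℕ+) : Edge .Binf (.B k)
  /-- `A_{k+1} < B_k` -/
  | A_B (k : ℕ+) : Edge (.A (k + 1)) (.B k)
  /-- `B_k < A_k` -/
  | B_A (k : ℕ+) : Edge (.B k) (.A k)
  /-- `A_1 < T` -/
  | A_T : Edge (.A 1) .T
  /-- `C_∞ < C_{k+1}` -/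
  | Cinf_C (k : ℕ+) : Edge .Cinf (.C k)
  /-- `D_{k+1} < C_{k+1}` -/
  | D_C (k : ℕ+) : Edge (.D (k + 1)) (.C k)
  /-- `C_{k+1} < D_k` -/
  | C_D (k : ℕ+) : Edge (.C k) (.D k)
  /-- `C_{k+1} < B_k` -/
  | C_B (k : ℕ+) : Edge (.C k) (.B k)
  /-- `D_k < A_k` -/
  | D_A (k : ℕ+) : Edge (.D k) (.A k)

/-- The order of the diagram: the reflexive and transitive closure of its edges. -/
def DiagramLE (c d : ListIndex) : Prop := Relation.ReflTransGen Edge c d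

end MultisortedBoolean

namespace MultisortedBoolean

/-! ### The relation `◁`, duals and literals -/

section Basic

variable {n m : ℕ+} {f g h : BoolOp n}

/-! A literal is a component `f_i` or its dual. For operations idempotent in every sort, an at most
binary relation matters only if it omits exactly one pair, which says `f_v ◁ f_w` for two literals,
or is the graph of a bijection, which says `f_v = f_w`; all other restrictions come from unary
relations and hold by idempotence. Sorts on which some unary polymorphism is constant can be
discarded, and on the others composing with the unary minor makes every polymorphism idempotent.
Hence `Pol Γ` is equivalent to a `constraintMinion` whose constraints are deductively closed
(`exists_pol_equivalent`).

Two data classify such a system: the length of a longest chain of literals under `◁`, and the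
presence of a self-dual literal. A literal with `v ◁ v` makes the chain infinite. Folding a longest
chain at its middle, by `f_v ⊓ dual f_w` for the two literals at equal distance from the ends, gives
a homomorphism to `A_k` or `B_k` according to the parity. A self-dual literal gives one to `D_1`,
and the operation `mid` combines the two into a homomorphism to `D_k` or `C_{k+1}`. Conversely, one
literal of each opposite pair is selected compatibly with the constraints and sent to the component
indexed by its height, the longest chain below it (`exists_isOrientation`,
`homLE_constraintMinion`). This is `exists_listMinion_equivalent_constraintMinion`.

The diagram is the order given by the two invariants `level` and `duality`. That homomorphisms
respect them reduces to five cases without homomorphism: `T` to `A_1`, `B_∞` to `D_1`, `C_∞` to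
`D_∞`, `D_k` to `B_k`, `C_{k+1}` to `A_{k+1}`. Apart from the first, these are proved by following
the value at `(0, 1)` of the images of binary operations: a ternary member of the source links two
of its binary minors, and a constraint `◁` of the target carries the value from one image to the
other (`ImageValue.step`, `ImageValue.not_step`).

The same calculus proves the minions to be cores. An endomorphism is determined by its binary part,
and there it is the identity, except that in `C_{k+1}` and `C_∞` it may exchange the arguments of
operations in which only the self-dual component distinguishes them; so its square is the identity.
-/

theorem Tri.trans (hfg : Tri f g) (hgh : Tri g h) : Tri f h :=
  fun a b hab => (hfg a a le_rfl).trans (hgh a b hab)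

theorem Tri.le (hfg : Tri f g) : f ≤ g := fun a => hfg a a le_rfl

theorem Tri.trans_le (hfg : Tri f g) (hgh : g ≤ h) : Tri f h :=
  fun a b hab => (hfg a b hab).trans (hgh b)

theorem Tri.le_trans (hfg : f ≤ g) (hgh : Tri g h) : Tri f h :=
  fun a b hab => (hfg a).trans (hgh a b hab)

theorem dual_dual (f : BoolOp n) : dual (dual f) = f := by
  funext a
  simp [dual]

theorem Tri.dual (hfg : Tri f g) : Tri (dual g) (dual f) := by
  intro a b hab
  have := hfg (fun i => !(b i)) (fun i => !(a i)) (fun i => by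
    have := hab i
    revert this
    beta_reduce
    cases a i <;> cases b i <;> simp)
  revert this
  simp only [MultisortedBoolean.dual]
  cases f (fun i => !(b i)) <;> cases g (fun i => !(a i)) <;> simp

theorem dual_le_dual (hfg : f ≤ g) : dual g ≤ dual f := by
  intro a
  have := hfg (fun i => !(a i))
  revert this
  simp only [dual]
  cases f (fun i => !(a i)) <;> cases g (fun i => !(a i)) <;> simp

theorem dual_inf (f g : BoolOp n) : dual (f ⊓ g) = dual f ⊔ dual g := by
  funext a
  simp [dual]

theorem dual_sup (f g : BoolOp n) : dual (f ⊔ g) = dual f ⊓ dual g := by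
  funext a
  simp [dual]

theorem Tri.inf {f' g' : BoolOp n} (h₁ : Tri f g) (h₂ : Tri f' g') : Tri (f ⊓ f') (g ⊓ g') :=
  fun a b hab => inf_le_inf (h₁ a b hab) (h₂ a b hab)

/-- The self-dual operation between `c` and its dual that agrees with `g` where these differ. -/
def mid (c g : BoolOp n) : BoolOp n := c ⊔ (g ⊓ dual c)

theorem le_mid (c g : BoolOp n) : c ≤ mid c g := le_sup_left

/-- The dual is `dual c ⊓ (g ⊔ c)`, which is the same operation by the modular law, since `c ≤ dual
c`. -/
theorem dual_mid {c g : BoolOp n} (hc : c ≤ dual c) (hg : g = dual g) :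
    mid c g = dual (mid c g) := by
  rw [mid, dual_sup, dual_inf, dual_dual, ← hg]
  rw [sup_comm g c, inf_comm (dual c), sup_inf_assoc_of_le g hc]

theorem apply_const_dual {x : Bool} (hf : ∀ x : Bool, f (fun _ => x) = x) :
    dual f (fun _ => x) = x := by
  simp [dual, hf]

end Basic

section Literals

variable {k : ℕ} {n : ℕ+}

/-- A literal is a sort together with a sign. The literal `(i, false)` stands for the dual of the
component of the sort `i`. -/
abbrev Literal (k : ℕ) := Fin k × Bool

/-- The opposite literal. -/
def Literal.neg (v : Literal k) : Literal k := (v.1, !v.2)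

theorem Literal.neg_neg (v : Literal k) : v.neg.neg = v := by
  simp [Literal.neg]

/-- The component of an operation at a literal. -/
def lit (f : Op (boolSorts k) (boolSorts k) n) (v : Literal k) : BoolOp n :=
  if v.2 then f v.1 else dual (f v.1)

@[simp] theorem lit_true (f : Op (boolSorts k) (boolSorts k) n) (i : Fin k) :
    lit f (i, true) = f i := rfl

@[simp] theorem lit_false (f : Op (boolSorts k) (boolSorts k) n) (i : Fin k) :
    lit f (i, false) = dual (f i) := rfl

theorem lit_neg (f : Op (boolSorts k) (boolSorts k) n) (v : Literal k) :
    lit f v.neg = dual (lit f v) := by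
  rcases v with ⟨i, _ | _⟩ <;> simp [Literal.neg, dual_dual]

theorem lit_minor {m : ℕ+} (f : Op (boolSorts k) (boolSorts k) n) (α : Fin n → Fin m)
    (v : Literal k) : lit (f.minor α) v = fun a => lit f v (a ∘ α) := by
  rcases v with ⟨i, _ | _⟩ <;> rfl

theorem lit_const {f : Op (boolSorts k) (boolSorts k) n} (hf : f.Idempotent) (v : Literal k)
    (x : Bool) : lit f v (fun _ => x) = x := by
  rcases v with ⟨i, _ | _⟩
  · exact apply_const_dual (hf i)
  · exact hf i x

/-- Negating the arguments where the signs require it turns `a ≤ b` into the condition that no pair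
`(a t, b t)` is the omitted pair `(x, y)`. Thus `◁` between literals is preservation of a binary
relation with three pairs. -/
theorem tri_lit_iff (f : Op (boolSorts k) (boolSorts k) n) (i j : Fin k) (x y : Bool) :
    Tri (lit f (i, x)) (lit f (j, !y)) ↔
      ∀ a b : Fin n → Bool, (∀ t, ¬(a t = x ∧ b t = y)) → ¬(f i a = x ∧ f j b = y) := by
  have aux : ∀ p q : Bool, (p ≤ q ↔ ¬(p = true ∧ q = false)) := by decide
  constructor
  · intro H a b hab
    have key := H (fun t => if x then a t else !(a t)) (fun t => if y then !(b t) else b t) (by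
      intro t
      have := hab t
      revert this
      beta_reduce
      cases x <;> cases y <;> cases a t <;> cases b t <;> simp)
    revert key
    cases x <;> cases y <;> simp [dual, aux]
  · intro H a b hab
    have key := H (fun t => if x then a t else !(a t)) (fun t => if y then !(b t) else b t) (by
      intro t
      have := hab t
      revert this
      beta_reduce
      cases x <;> cases y <;> cases a t <;> cases b t <;> simp)
    revert key
    cases x <;> cases y <;> simp [dual, aux]

theorem lit_eq_iff (f : Op (boolSorts k) (boolSorts k) n) (i j : Fin k) (x y : Bool) :
    lit f (i, x) = lit f (j, !y) ↔
      ∀ a b : Fin n → Bool, (∀ t, a t = x ↔ ¬(b t = y)) → (f i a = x ↔ ¬(f j b = y)) := by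
  constructor
  · intro H a b hab
    have key := congrFun H (fun t => if x then a t else !(a t))
    have hb : b = fun t => if x = y then !(a t) else a t := by
      funext t
      have := hab t
      revert this
      cases x <;> cases y <;> cases a t <;> cases b t <;> simp
    subst hb
    revert key
    cases x <;> cases y <;> simp [dual]
  · intro H
    funext a
    have key := H (fun t => if x then a t else !(a t)) (fun t => if y then !(a t) else a t) (by
      intro t
      cases x <;> cases y <;> cases a t <;> simp)
    revert key
    cases x <;> cases y <;> simp [dual]

end Literals

/-! ### Homomorphisms given by formulas, and minions given by constraints -/

namespace Minion

theorem HomLE.trans {M N P : Minion.{0}} : HomLE M N → HomLE N P → HomLE M P :=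
  fun ⟨ξ⟩ ⟨ζ⟩ => ⟨ζ.comp ξ⟩

theorem Equivalent.symm {M N : Minion.{0}} (h : Equivalent M N) : Equivalent N M := ⟨h.2, h.1⟩

theorem Equivalent.trans {M N P : Minion.{0}} (h₁ : Equivalent M N) (h₂ : Equivalent N P) :
    Equivalent M P := ⟨h₁.1.trans h₂.1, h₂.2.trans h₁.2⟩

end Minion

section Formula

variable {k l : ℕ} {A B : Fin k → Type} {A' B' : Fin l → Type}

theorem homLE_of_formula {M : FunctionMinion A B} {N : FunctionMinion A' B'}
    (Φ : ∀ n, Op A B n → Op A' B' n)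
    (hΦ : ∀ {n m : ℕ+} (α : Fin n → Fin m) (f : Op A B n), Φ m (f.minor α) = (Φ n f).minor α)
    (mem : ∀ n f, f ∈ M.ops n → Φ n f ∈ N.ops n) : M.toMinion.HomLE N.toMinion :=
  ⟨⟨fun n f => ⟨Φ n f.1, mem n f.1 f.2⟩, fun α f => Subtype.ext (hΦ α f.1)⟩⟩

end Formula

/-- The idempotent operations that satisfy given constraints `f_v ◁ f_w` and `f_v = f_w` between
literals. -/
def constraintMinion (k : ℕ) (E Q : Literal k → Literal k → Prop) :
    FunctionMinion (boolSorts k) (boolSorts k) where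
  ops _ := {f | f.Idempotent ∧ (∀ v w, E v w → Tri (lit f v) (lit f w)) ∧
    (∀ v w, Q v w → lit f v = lit f w)}
  nonempty := by
    have H : ∀ v : Literal k, lit (Op.proj (boolSorts k) 1 0) v = fun a => a 0 := by
      rintro ⟨i, _ | _⟩
      · exact dual_proj (n := 1) 0
      · rfl
    exact ⟨1, Op.proj _ 1 0, fun _ _ => rfl, fun v w _ => by rw [H, H]; exact tri_proj 0,
      fun v w _ => by rw [H, H]⟩
  minor_mem f α h := ⟨fun i a => h.1 i a,
    fun v w hvw => by rw [lit_minor, lit_minor]; exact tri_minor α (h.2.1 v w hvw),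
    fun v w hvw => by rw [lit_minor, lit_minor]; exact eq_minor α (h.2.2 v w hvw)⟩

/-! ### At most binary relations and constraints -/

section Relations

variable {k : ℕ}

/-- Unary relations are treated as binary ones with an ignored second coordinate, so that later
arguments have a single case. -/
theorem exists_preserves_iff (R : SortedRelation (boolSorts k)) (hR : R.arity ≤ 2) :
    ∃ (i j : Fin k) (P : Bool → Bool → Prop), ∀ (n : ℕ+) (f : Op (boolSorts k) (boolSorts k) n),
      f.Preserves R ↔
        ∀ a b : Fin n → Bool, (∀ t, P (a t) (b t)) → P (f i a) (f j b) := by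
  obtain ⟨m, sort, T⟩ := R
  have hm : m = 1 ∨ m = 2 := by
    have h1 : (m : ℕ) ≤ 2 := hR
    have h2 := m.pos
    rcases (show (m : ℕ) = 1 ∨ (m : ℕ) = 2 by omega) with h | h
    · exact Or.inl (PNat.eq h)
    · exact Or.inr (PNat.eq h)
  rcases hm with rfl | rfl
  · refine ⟨sort 0, sort 0, fun x _ => (fun _ => x) ∈ T, fun n f => ⟨fun H a _ ha => ?_,
      fun H r hr => ?_⟩⟩
    · have := H (fun t _ => a t) ha
      convert this using 2 with l
      obtain rfl : l = 0 := Subsingleton.elim (α := Fin 1) l 0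
      rfl
    · have aux : ∀ u : Fin 1 → Bool, (fun _ => u 0) = u := fun u =>
        funext fun l => congrArg u (Subsingleton.elim 0 l)
      have := H (fun t => r t 0) (fun t => r t 0) (fun t => by
        have := hr t
        rwa [← aux (r t)] at this)
      convert this using 2 with l
      obtain rfl : l = 0 := Subsingleton.elim (α := Fin 1) l 0
      rfl
  · have aux : ∀ u : Fin 2 → Bool, ![u 0, u 1] = u := fun u => by
      funext l
      fin_cases l <;> rfl
    refine ⟨sort 0, sort 1, fun x y => (![x, y] : Fin 2 → Bool) ∈ T, fun n f =>
      ⟨fun H a b hab => ?_, fun H r hr => ?_⟩⟩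
    · have := H (fun t => (![a t, b t] : Fin 2 → Bool)) hab
      have haux := aux fun l => f (sort l) fun t => (![a t, b t] : Fin 2 → Bool) l
      exact Set.mem_of_eq_of_mem haux this
    · have := H (fun t => r t 0) (fun t => r t 1) (fun t => by
        have := hr t
        rwa [← aux (r t)] at this)
      have haux := aux fun l => f (sort l) fun t => r t l
      exact haux ▸ this

/-- The binary relation of type `(i, j)` that is given by a predicate. -/
def binaryRelation (i j : Fin k) (P : Bool → Bool → Prop) : SortedRelation (boolSorts k) where
  arity := 2
  sort := ![i, j]
  tuples := {t | P (t (0 : Fin 2)) (t (1 : Fin 2))}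

theorem preserves_binaryRelation (i j : Fin k) (P : Bool → Bool → Prop) {n : ℕ+}
    (f : Op (boolSorts k) (boolSorts k) n) :
    f.Preserves (binaryRelation i j P) ↔
      ∀ a b : Fin n → Bool, (∀ t, P (a t) (b t)) → P (f i a) (f j b) :=
  ⟨fun H a b hab => H (fun t => (![a t, b t] : Fin 2 → Bool)) hab,
    fun H r hr => H (fun t => r t (0 : Fin 2)) (fun t => r t (1 : Fin 2)) hr⟩

theorem exists_equivalent_pol (E Q : Literal k → Literal k → Prop) :
    ∃ Γ : Set (SortedRelation (boolSorts k)), (∀ R ∈ Γ, R.arity ≤ 2) ∧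
      (constraintMinion k E Q).toMinion.Equivalent (Pol Γ).toMinion := by
  let Γ : Set (SortedRelation (boolSorts k)) :=
    {R | (∃ i x, R = binaryRelation i i (fun s _ => s = x)) ∨
      (∃ v w, E v w ∧ R = binaryRelation v.1 w.1 (fun s t => ¬(s = v.2 ∧ t = !w.2))) ∨
      (∃ v w, Q v w ∧ R = binaryRelation v.1 w.1 (fun s t => (s = v.2 ↔ ¬(t = !w.2))))}
  have key : ∀ (n : ℕ+) (f : Op (boolSorts k) (boolSorts k) n),
      f ∈ (Pol Γ).ops n ↔ f ∈ (constraintMinion k E Q).ops n := by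
    intro n f
    have hE : ∀ v w : Literal k, f.Preserves
        (binaryRelation v.1 w.1 (fun s t => ¬(s = v.2 ∧ t = !w.2))) ↔
          Tri (lit f v) (lit f w) := by
      intro v w
      rw [preserves_binaryRelation, ← tri_lit_iff, Bool.not_not]
    have hQ : ∀ v w : Literal k, f.Preserves
        (binaryRelation v.1 w.1 (fun s t => (s = v.2 ↔ ¬(t = !w.2)))) ↔
          lit f v = lit f w := by
      intro v w
      rw [preserves_binaryRelation, ← lit_eq_iff, Bool.not_not]
    have hI : ∀ i x, f.Preserves (binaryRelation i i (fun s _ => s = x)) ↔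
        f i (fun _ => x) = x := by
      intro i x
      rw [preserves_binaryRelation]
      refine ⟨fun H => H _ (fun _ => x) fun _ => rfl, fun H a _ ha => ?_⟩
      rw [show a = fun _ => x from funext ha, H]
    constructor
    · intro H
      exact ⟨fun i x => (hI i x).1 (H _ (Or.inl ⟨i, x, rfl⟩)),
        fun v w h => (hE v w).1 (H _ (Or.inr (Or.inl ⟨v, w, h, rfl⟩))),
        fun v w h => (hQ v w).1 (H _ (Or.inr (Or.inr ⟨v, w, h, rfl⟩)))⟩
    · rintro ⟨h1, h2, h3⟩ R (⟨i, x, rfl⟩ | ⟨v, w, h, rfl⟩ | ⟨v, w, h, rfl⟩)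
      · exact (hI i x).2 (h1 i x)
      · exact (hE v w).2 (h2 v w h)
      · exact (hQ v w).2 (h3 v w h)
  refine ⟨Γ, ?_, homLE_of_formula (fun _ f => f) (fun _ _ => rfl) fun n f => (key n f).2,
    homLE_of_formula (fun _ f => f) (fun _ _ => rfl) fun n f => (key n f).1⟩
  rintro R (⟨i, x, rfl⟩ | ⟨v, w, h, rfl⟩ | ⟨v, w, h, rfl⟩) <;> exact le_rfl

end Relations

/-! ### Reduction to constraints between idempotent operations -/

section Reduction

variable {k : ℕ} {Γ : Set (SortedRelation (boolSorts k))}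

theorem comp_mem_pol {n : ℕ+} {u : Op (boolSorts k) (boolSorts k) 1}
    {f : Op (boolSorts k) (boolSorts k) n} (hu : u ∈ (Pol Γ).ops 1) (hf : f ∈ (Pol Γ).ops n) :
    (fun i a => u i (fun _ => f i a) : Op (boolSorts k) (boolSorts k) n) ∈ (Pol Γ).ops n :=
  fun R hR r hr => hu R hR (fun _ j => f (R.sort j) (fun i => r i j)) fun _ => hf R hR r hr

theorem apply_apply_of_ne : ∀ g : Bool → Bool, g true ≠ g false → ∀ x, g (g x) = x := by
  decide

/-- Some unary polymorphism is constant on the sort `i`. -/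
def IsCollapsible (Γ : Set (SortedRelation (boolSorts k))) (i : Fin k) : Prop :=
  ∃ u ∈ (Pol Γ).ops 1, ∃ c, ∀ a, u i a = c

/-- Composing unary polymorphisms accumulates the sorts on which the result is constant. On a sort
that is never collapsed the result is a permutation of `{0, 1}`, so its square is the identity
there. -/
theorem exists_collapse (Γ : Set (SortedRelation (boolSorts k))) :
    ∃ e ∈ (Pol Γ).ops 1, ∃ c : Fin k → Bool, (∀ i, IsCollapsible Γ i → ∀ a, e i a = c i) ∧
      ∀ i, ¬ IsCollapsible Γ i → ∀ x, e i (fun _ => x) = x := by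
  classical
  have step : ∀ s : Finset (Fin k), ∃ e ∈ (Pol Γ).ops 1,
      ∀ i ∈ s, IsCollapsible Γ i → ∃ c, ∀ a, e i a = c := by
    intro s
    induction s using Finset.induction_on with
    | empty => exact ⟨Op.proj _ 1 0, fun _ _ _ hr => hr 0, by simp⟩
    | insert i s _ ih =>
      obtain ⟨e, he, hes⟩ := ih
      by_cases hi : IsCollapsible Γ i
      · obtain ⟨u, hu, c, hc⟩ := hi
        refine ⟨_, comp_mem_pol hu he, fun j hj hjc => ?_⟩
        rcases Finset.mem_insert.1 hj with rfl | hj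
        · exact ⟨c, fun a => hc _⟩
        · obtain ⟨c', hc'⟩ := hes j hj hjc
          exact ⟨u j fun _ => c', fun a => by simp only [hc']⟩
      · refine ⟨e, he, fun j hj hjc => ?_⟩
        rcases Finset.mem_insert.1 hj with rfl | hj
        · exact absurd hjc hi
        · exact hes j hj hjc
  obtain ⟨e, he, hc⟩ := step Finset.univ
  refine ⟨_, comp_mem_pol he he, fun i => e i fun _ => e i fun _ => true, fun i hi a => ?_,
    fun i hi x => ?_⟩
  · obtain ⟨c, hc⟩ := hc i (Finset.mem_univ i) hi
    simp only [hc]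
  · have hne : e i (fun _ => true) ≠ e i (fun _ => false) := by
      intro heq
      refine hi ⟨e, he, e i (fun _ => true), fun a => ?_⟩
      have ha : a = fun _ => a 0 := funext fun t => congrArg a (Subsingleton.elim (α := Fin 1) _ _)
      rw [ha]
      cases a 0
      · exact heq.symm
      · rfl
    exact apply_apply_of_ne (fun x => e i fun _ => x) hne x

/-- The constraints are all those that hold in the minion which they determine. -/
structure IsFull {m : ℕ} (E Q : Literal m → Literal m → Prop) : Prop where
  tri : ∀ v w, (∀ n, ∀ f ∈ (constraintMinion m E Q).ops n, Tri (lit f v) (lit f w)) → E v w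
  eq : ∀ v w, (∀ n, ∀ f ∈ (constraintMinion m E Q).ops n, lit f v = lit f w) → Q v w

/-- Only the sorts without a constant unary polymorphism survive. Passing to them, every
polymorphism is made idempotent by composing it with its unary minor; in the other direction the
lost components are filled with the constants of a collapsing polymorphism. -/
theorem exists_pol_equivalent (Γ : Set (SortedRelation (boolSorts k)))
    (hΓ : ∀ R ∈ Γ, R.arity ≤ 2) :
    ∃ (m : ℕ) (E Q : Literal m → Literal m → Prop), IsFull E Q ∧
      (Pol Γ).toMinion.Equivalent (constraintMinion m E Q).toMinion := by
  classical
  obtain ⟨e, he, c, hec, hel⟩ := exists_collapse Γ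
  let m := Fintype.card {i : Fin k // ¬ IsCollapsible Γ i}
  let φ : {i : Fin k // ¬ IsCollapsible Γ i} ≃ Fin m := Fintype.equivFin _
  let σ : Fin m → Fin k := fun j => (φ.symm j).1
  let res : ∀ n, Op (boolSorts k) (boolSorts k) n → Op (boolSorts m) (boolSorts m) n :=
    fun n f j => f (σ j)
  -- `E` and `Q` collect every constraint valid for the polymorphisms that are idempotent on the
  -- surviving sorts. Their restrictions belong to the constraint minion, which makes fullness
  -- immediate.
  let E : Literal m → Literal m → Prop := fun v w => ∀ n, ∀ f ∈ (Pol Γ).ops n,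
    (res n f).Idempotent → Tri (lit (res n f) v) (lit (res n f) w)
  let Q : Literal m → Literal m → Prop := fun v w => ∀ n, ∀ f ∈ (Pol Γ).ops n,
    (res n f).Idempotent → lit (res n f) v = lit (res n f) w
  have hres : ∀ n, ∀ f ∈ (Pol Γ).ops n, (res n f).Idempotent →
      res n f ∈ (constraintMinion m E Q).ops n := fun n f hf hid =>
    ⟨hid, fun v w h => h n f hf hid, fun v w h => h n f hf hid⟩
  refine ⟨m, E, Q, ⟨fun v w h n f hf hid => h n _ (hres n f hf hid),
    fun v w h n f hf hid => h n _ (hres n f hf hid)⟩, ?_, ?_⟩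
  · -- compose with the unary minor, which is a permutation in every remaining sort
    let sq : ∀ n, Op (boolSorts k) (boolSorts k) n → Op (boolSorts k) (boolSorts k) n :=
      fun n f i a => f i (fun _ => f i a)
    refine homLE_of_formula (fun n f => res n (sq n f)) (fun _ _ => rfl) fun n f hf => ?_
    have hu : f.minor (m := 1) (fun _ => (0 : Fin 1)) ∈ (Pol Γ).ops 1 := (Pol Γ).minor_mem f _ hf
    refine hres n _ (comp_mem_pol hu hf) fun j x => ?_
    change f (σ j) (fun _ => f (σ j) fun _ => x) = x
    have hne : f (σ j) (fun _ => true) ≠ f (σ j) (fun _ => false) := by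
      intro heq
      refine (φ.symm j).2 ⟨_, hu, f (σ j) (fun _ => true), fun a => ?_⟩
      change f (σ j) (fun _ => a 0) = _
      cases a 0
      · exact heq.symm
      · rfl
    exact apply_apply_of_ne (fun x => f (σ j) fun _ => x) hne x
  · -- extend by constants
    let ext : ∀ n, Op (boolSorts m) (boolSorts m) n → Op (boolSorts k) (boolSorts k) n :=
      fun n f i a => if hi : IsCollapsible Γ i then c i else f (φ ⟨i, hi⟩) a
    refine homLE_of_formula ext (fun _ _ => rfl) fun n f hf R hR => ?_
    obtain ⟨i, j, P, hP⟩ := exists_preserves_iff R (hΓ R hR)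
    rw [hP]
    intro a b hab
    have heP : ∀ x y, P x y → P (e i fun _ => x) (e j fun _ => y) := fun x y hxy =>
      (hP 1 e).1 (he R hR) (fun _ => x) (fun _ => y) fun _ => hxy
    let t₀ : Fin n := ⟨0, n.pos⟩
    -- An idempotent component preserves each unary relation `S`: either `S` is everything, or `d`
    -- is constant.
    have hunary : ∀ (l : Fin m) (S : Bool → Prop) (d : Fin n → Bool), (∀ t, S (d t)) →
        S (f l d) := by
      intro l S d hd
      by_cases hall : ∀ x, S x
      · exact hall _
      · obtain ⟨x, hx⟩ := not_forall.1 hall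
        have hd' : d = fun _ => !x := by
          funext t
          have : d t ≠ x := fun h => hx (h ▸ hd t)
          revert this
          cases d t <;> cases x <;> simp
        have := hd t₀
        rw [hd'] at this ⊢
        rw [hf.1 l]
        exact this
    by_cases hi : IsCollapsible Γ i <;> by_cases hj : IsCollapsible Γ j
    · simp only [ext, hi, hj, dif_pos]
      have := heP _ _ (hab t₀)
      rwa [hec i hi, hec j hj] at this
    · simp only [ext, hi, hj, dif_pos, dif_neg, not_false_eq_true]
      refine hunary _ (P (c i)) b fun t => ?_
      have := heP _ _ (hab t)
      rwa [hec i hi, hel j hj] at this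
    · simp only [ext, hi, hj, dif_pos, dif_neg, not_false_eq_true]
      refine hunary _ (fun x => P x (c j)) a fun t => ?_
      have := heP _ _ (hab t)
      rwa [hel i hi, hec j hj] at this
    · simp only [ext, hi, hj, dif_neg, not_false_eq_true]
      set i' := φ ⟨i, hi⟩ with hi'
      set j' := φ ⟨j, hj⟩ with hj'
      have hσi : σ i' = i := by simp [σ, hi']
      have hσj : σ j' = j := by simp [σ, hj']
      -- The sorts `σ i'` and `i` are equal only propositionally, so the description of `R` is
      -- restated for variables.
      have hP' : ∀ i₁ j₁, i₁ = i → j₁ = j → ∀ (n : ℕ+) (f : Op (boolSorts k) (boolSorts k) n),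
          f.Preserves R ↔
            ∀ a b : Fin n → Bool, (∀ t, P (a t) (b t)) → P (f i₁ a) (f j₁ b) := by
        rintro _ _ rfl rfl
        exact hP
      -- Suppose the pair `(x, y)` of values is not in the relation. If a neighbouring pair is
      -- missing too, one argument is constant and idempotence contradicts its value. So the
      -- relation omits only `(x, y)`, or omits exactly the two opposite pairs; these are a
      -- constraint in `E` and one in `Q`.
      by_contra hmiss
      obtain ⟨x, hx⟩ : ∃ x, x = f i' a := ⟨_, rfl⟩
      obtain ⟨y, hy⟩ : ∃ y, y = f j' b := ⟨_, rfl⟩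
      rw [← hx, ← hy] at hmiss
      have cases_bool : ∀ s r : Bool, s = r ∨ s = !r := by decide
      have bool_ne : ∀ s r : Bool, s = r ↔ ¬ (s = !r) := by decide
      by_cases h1 : P (!x) y
      swap
      · -- the values of `b` are all different from `y`
        have hb : ∀ t, b t = !y := by
          intro t
          rcases cases_bool (a t) x with ha | ha <;> rcases cases_bool (b t) y with hb | hb
          · exact absurd (ha ▸ hb ▸ hab t) hmiss
          · exact hb
          · exact absurd (ha ▸ hb ▸ hab t) h1
          · exact hb
        have := hunary j' (· = !y) b hb
        rw [← hy] at this
        simp at this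
      by_cases h2 : P x (!y)
      swap
      · have ha : ∀ t, a t = !x := by
          intro t
          rcases cases_bool (a t) x with ha | ha <;> rcases cases_bool (b t) y with hb | hb
          · exact absurd (ha ▸ hb ▸ hab t) hmiss
          · exact absurd (ha ▸ hb ▸ hab t) h2
          · exact ha
          · exact ha
        have := hunary i' (· = !x) a ha
        rw [← hx] at this
        simp at this
      by_cases h3 : P (!x) (!y)
      · have hPiff : ∀ s r, P s r ↔ ¬(s = x ∧ r = y) := by
          intro s r
          rcases cases_bool s x with h | h <;> rcases cases_bool r y with h' | h' <;>
            rw [h, h'] <;> simp [hmiss, h1, h2, h3]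
        have hE : E (i', x) (j', !y) := by
          intro n' f' hf' _
          rw [tri_lit_iff]
          have := (hP' (σ i') (σ j') hσi hσj n' f').1 (hf' R hR)
          simpa only [hPiff] using this
        have := (tri_lit_iff f i' j' x y).1 (hf.2.1 _ _ hE) a b fun t => (hPiff _ _).1 (hab t)
        exact this ⟨hx.symm, hy.symm⟩
      · have hPiff : ∀ s r, P s r ↔ (s = x ↔ ¬(r = y)) := by
          intro s r
          rcases cases_bool s x with h | h <;> rcases cases_bool r y with h' | h' <;>
            rw [h, h'] <;> simp [hmiss, h1, h2, h3]
        have hQ : Q (i', x) (j', !y) := by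
          intro n' f' hf' _
          rw [lit_eq_iff]
          have := (hP' (σ i') (σ j') hσi hσj n' f').1 (hf' R hR)
          simpa only [hPiff] using this
        have := (lit_eq_iff f i' j' x y).1 (hf.2.2 _ _ hQ) a b fun t => (hPiff _ _).1 (hab t)
        exact this.1 hx.symm hy.symm

end Reduction

/-! ### Homomorphisms between the minions on the list -/

section Homs

/-- The bound `K` allows for `C_{k+1}`, whose last link is only `≤` and has to be left out of the
chain. -/
theorem tri_of_lt {k : ℕ} {n : ℕ+} {h : Op (boolSorts k) (boolSorts k) n} {K : ℕ}
    (H : ∀ i j : Fin k, (i : ℕ) + 1 = j → (j : ℕ) < K → Tri (h i) (h j)) :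
    ∀ i j : Fin k, i < j → (j : ℕ) < K → Tri (h i) (h j) := by
  rintro i ⟨j, hj⟩ hij hK
  induction j with
  | zero => exact absurd hij (Nat.not_lt_zero _)
  | succ j ih =>
    rcases Nat.lt_succ_iff_lt_or_eq.1 (show (i : ℕ) < j + 1 from hij) with hlt | heq
    · exact (ih (by omega) hlt (Nat.lt_of_succ_lt hK)).trans (H ⟨j, by omega⟩ _ rfl hK)
    · exact H i _ (by simp [heq]) hK

theorem minionDinf_le_minionCinf : minionDinf.toMinion.HomLE minionCinf.toMinion :=
  homLE_of_formula (fun _ f _ => f 0) (fun _ _ => rfl) fun _ _ hf =>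
    ⟨fun _ => hf.1 0, hf.2.1, hf.2.1, hf.2.2⟩

theorem minionCinf_le_minionBinf : minionCinf.toMinion.HomLE minionBinf.toMinion :=
  homLE_of_formula (fun _ f _ => f 0) (fun _ _ => rfl) fun _ _ hf =>
    ⟨fun _ => hf.1 0, hf.2.1, hf.2.2.1.trans (hf.2.2.2 ▸ hf.2.2.1.dual)⟩

theorem minionBinf_le_minionB (k : ℕ+) : minionBinf.toMinion.HomLE (minionB k).toMinion :=
  homLE_of_formula (fun _ f _ => f 0) (fun _ _ => rfl) fun _ _ hf =>
    ⟨fun _ => hf.1 0, fun _ _ _ => hf.2.1, fun _ _ => hf.2.2⟩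

theorem minionA_le_minionB (k : ℕ+) : (minionA (k + 1)).toMinion.HomLE (minionB k).toMinion := by
  have hk : ((k + 1 : ℕ+) : ℕ) = k + 1 := PNat.add_coe k 1
  refine homLE_of_formula (fun _ f i => f ⟨i, by omega⟩) (fun _ _ => rfl) fun _ f hf =>
    ⟨fun _ => hf.1 _, fun i j hij => hf.2.1 _ _ hij, fun i hi => ?_⟩
  have h := hf.2.1 ⟨i, by omega⟩ ⟨i + 1, by omega⟩ rfl
  exact (h.trans_le (hf.2.2 ⟨i + 1, by omega⟩ (by simp; omega))).trans h.dual

theorem minionB_le_minionA (k : ℕ+) : (minionB k).toMinion.HomLE (minionA k).toMinion :=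
  homLE_of_formula (fun _ f => f) (fun _ _ => rfl) fun _ _ hf =>
    ⟨hf.1, hf.2.1, fun i hi => (hf.2.2 i hi).le⟩

theorem homLE_minionT {k : ℕ} {A B : Fin k → Type} (M : FunctionMinion A B) :
    M.toMinion.HomLE minionT.toMinion :=
  homLE_of_formula (fun _ _ _ _ => ()) (fun _ _ => rfl) fun _ _ _ => trivial

theorem minionD_le_minionC (k : ℕ+) :
    (minionD (k + 1)).toMinion.HomLE (minionC (k + 1)).toMinion := by
  have hk : ((k + 1 : ℕ+) : ℕ) = k + 1 := PNat.add_coe k 1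
  refine homLE_of_formula (fun _ f => f) (fun _ _ => rfl) fun _ f hf =>
    ⟨hf.1, fun i j hij _ => hf.2.1 i j hij, fun i j hij _ => (hf.2.1 i j hij).le, hf.2.2,
      fun i hi => ?_⟩
  have h := hf.2.1 i ⟨i + 1, by omega⟩ rfl
  exact h.trans (hf.2.2 ⟨i + 1, by omega⟩ (by simp; omega) ▸ h.dual)

theorem minionD_le_minionA (k : ℕ+) : (minionD k).toMinion.HomLE (minionA k).toMinion :=
  homLE_of_formula (fun _ f => f) (fun _ _ => rfl) fun _ _ hf =>
    ⟨hf.1, hf.2.1, fun i hi => (hf.2.2 i hi).le⟩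

theorem minionC_le_minionB (k : ℕ+) : (minionC (k + 1)).toMinion.HomLE (minionB k).toMinion := by
  have hk : ((k + 1 : ℕ+) : ℕ) = k + 1 := PNat.add_coe k 1
  exact homLE_of_formula (fun _ f i => f ⟨i, by omega⟩) (fun _ _ => rfl) fun _ f hf =>
    ⟨fun _ => hf.1 _, fun i j hij => hf.2.1 _ _ hij (by simp),
      fun i hi => hf.2.2.2.2 _ (by simp; omega)⟩

theorem minionCinf_le_minionD_one : minionCinf.toMinion.HomLE (minionD 1).toMinion :=
  homLE_of_formula (fun _ f _ => f 1) (fun _ _ => rfl) fun _ f hf =>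
    ⟨fun _ => hf.1 _, fun i j hij => by
      have := j.2
      have h1 : ((1 : ℕ+) : ℕ) = 1 := rfl
      omega, fun _ _ => hf.2.2.2⟩

theorem minionC_le_minionD_one (k : ℕ+) :
    (minionC (k + 1)).toMinion.HomLE (minionD 1).toMinion := by
  have hk : ((k + 1 : ℕ+) : ℕ) = k + 1 := PNat.add_coe k 1
  have h1 : ((1 : ℕ+) : ℕ) = 1 := rfl
  exact homLE_of_formula (fun _ f _ => f ⟨k, by omega⟩) (fun _ _ => rfl) fun _ f hf =>
    ⟨fun _ => hf.1 _, fun i j hij => by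
      have := j.2
      omega, fun _ _ => hf.2.2.2.1 _ (by simp)⟩

theorem mid_const {n : ℕ+} {c g : BoolOp n} (hc : ∀ x : Bool, c (fun _ => x) = x)
    (hg : ∀ x : Bool, g (fun _ => x) = x) (x : Bool) : mid c g (fun _ => x) = x := by
  simp [mid, dual, hc, hg]

theorem homLE_of_formula₂ {k l m : ℕ} {M : Minion.{0}}
    {N : FunctionMinion (boolSorts k) (boolSorts k)}
    {N' : FunctionMinion (boolSorts l) (boolSorts l)}
    {P : FunctionMinion (boolSorts m) (boolSorts m)}
    (hN : M.HomLE N.toMinion) (hN' : M.HomLE N'.toMinion)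
    (Φ : ∀ n, Op (boolSorts k) (boolSorts k) n → Op (boolSorts l) (boolSorts l) n →
      Op (boolSorts m) (boolSorts m) n)
    (hΦ : ∀ {n p : ℕ+} (α : Fin n → Fin p) f g,
      Φ p (f.minor α) (g.minor α) = (Φ n f g).minor α)
    (mem : ∀ n, ∀ f ∈ N.ops n, ∀ g ∈ N'.ops n, Φ n f g ∈ P.ops n) : M.HomLE P.toMinion := by
  obtain ⟨ξ⟩ := hN
  obtain ⟨ζ⟩ := hN'
  refine ⟨⟨fun n x => ⟨Φ n (ξ.app n x).1 (ζ.app n x).1, mem n _ (ξ.app n x).2 _ (ζ.app n x).2⟩,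
    fun α x => Subtype.ext ?_⟩⟩
  simp only [ξ.app_map, ζ.app_map]
  exact hΦ α _ _

/-- `D_k` is the meet of `A_k` and `D_1`: a self-dual operation is inserted between the last
component and its dual by `mid`. The last component only grows, so the link into it survives. -/
theorem homLE_minionD {M : Minion.{0}} {k : ℕ+} (hA : M.HomLE (minionA k).toMinion)
    (hD : M.HomLE (minionD 1).toMinion) : M.HomLE (minionD k).toMinion := by
  refine homLE_of_formula₂ hA hD
    (fun n f g i => if (i : ℕ) + 1 = k then mid (f i) (g 0) else f i) ?_ ?_
  · intro n p α f g
    funext i a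
    unfold Op.minor
    beta_reduce
    split_ifs <;> rfl
  · rintro n f ⟨hf, hf1, hf2⟩ g ⟨hg, -, hg2⟩
    refine ⟨fun i x => ?_, fun i j hij => ?_, fun i hi => ?_⟩
    · dsimp only
      split_ifs
      · exact mid_const (hf i) (hg 0) x
      · exact hf i x
    · have := j.2
      have hi : (i : ℕ) + 1 ≠ k := by omega
      simp only [hi, if_false]
      split_ifs
      · exact (hf1 i j hij).trans_le (le_mid _ _)
      · exact hf1 i j hij
    · simp only [hi, if_true]
      exact dual_mid (hf2 i hi) (hg2 0 rfl)

/-- `C_{k+1}` is the meet of `B_k` and `D_1`. The component built by `mid` is appended as a new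
sort, because replacing the last one would destroy the link `◁` to its dual. -/
theorem homLE_minionC {M : Minion.{0}} {k : ℕ+} (hB : M.HomLE (minionB k).toMinion)
    (hD : M.HomLE (minionD 1).toMinion) : M.HomLE (minionC (k + 1)).toMinion := by
  have hk : ((k + 1 : ℕ+) : ℕ) = k + 1 := PNat.add_coe k 1
  have hk' := k.pos
  refine homLE_of_formula₂ hB hD
    (fun n f g i => if hi : (i : ℕ) < k then f ⟨i, hi⟩ else mid (f ⟨k - 1, by omega⟩) (g 0)) ?_ ?_
  · intro n p α f g
    funext i a
    unfold Op.minor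
    beta_reduce
    split_ifs <;> rfl
  · rintro n f ⟨hf, hf1, hf2⟩ g ⟨hg, -, hg2⟩
    refine ⟨fun i x => ?_, fun i j hij hj => ?_, fun i j hij hj => ?_, fun i hi => ?_,
      fun i hi => ?_⟩
    · dsimp only
      split_ifs
      · exact hf _ x
      · exact mid_const (hf _) (hg 0) x
    · beta_reduce
      rw [dif_pos (show (i : ℕ) < k by omega), dif_pos (show (j : ℕ) < k by omega)]
      exact hf1 _ _ hij
    · beta_reduce
      rw [dif_pos (show (i : ℕ) < k by omega), dif_neg (show ¬ (j : ℕ) < k by omega)]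
      have : (⟨i, by omega⟩ : Fin k) = ⟨k - 1, by omega⟩ := Fin.ext (by simp; omega)
      rw [this]
      exact le_mid _ _
    · beta_reduce
      rw [dif_neg (show ¬ (i : ℕ) < k by omega)]
      exact dual_mid (hf2 _ (by simp; omega)).le (hg2 0 rfl)
    · beta_reduce
      rw [dif_pos (show (i : ℕ) < k by omega)]
      exact hf2 _ (by simp; omega)

theorem homLE_minionCinf {M : Minion.{0}} (hB : M.HomLE minionBinf.toMinion)
    (hD : M.HomLE (minionD 1).toMinion) : M.HomLE minionCinf.toMinion := by
  refine homLE_of_formula₂ hB hD (fun n f g i => if i = 0 then f 0 else mid (f 0) (g 0)) ?_ ?_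
  · intro n p α f g
    funext i a
    unfold Op.minor
    beta_reduce
    split_ifs <;> rfl
  · rintro n f ⟨hf, hf1, hf2⟩ g ⟨hg, -, hg2⟩
    refine ⟨fun i x => ?_, hf1, hf1.trans_le (le_mid _ _), dual_mid hf2.le (hg2 0 rfl)⟩
    dsimp only
    split_ifs
    · exact hf _ x
    · exact mid_const (hf _) (hg 0) x

theorem minionCinf_le_minionC (k : ℕ+) :
    minionCinf.toMinion.HomLE (minionC (k + 1)).toMinion :=
  homLE_minionC (minionCinf_le_minionBinf.trans (minionBinf_le_minionB k))
    minionCinf_le_minionD_one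

theorem minionC_le_minionD (k : ℕ+) : (minionC (k + 1)).toMinion.HomLE (minionD k).toMinion :=
  homLE_minionD ((minionC_le_minionB k).trans (minionB_le_minionA k)) (minionC_le_minionD_one k)

theorem homLE_of_edge {c d : ListIndex} (h : Edge c d) :
    (listMinion c).HomLE (listMinion d) := by
  cases h with
  | Dinf_Cinf => exact minionDinf_le_minionCinf
  | Cinf_Binf => exact minionCinf_le_minionBinf
  | Binf_B k => exact minionBinf_le_minionB k
  | A_B k => exact minionA_le_minionB k
  | B_A k => exact minionB_le_minionA k
  | A_T => exact homLE_minionT _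
  | Cinf_C k => exact minionCinf_le_minionC k
  | D_C k => exact minionD_le_minionC k
  | C_D k => exact minionC_le_minionD k
  | C_B k => exact minionC_le_minionB k
  | D_A k => exact minionD_le_minionA k

theorem homLE_of_diagramLE {c d : ListIndex} (h : DiagramLE c d) :
    (listMinion c).HomLE (listMinion d) := by
  induction h with
  | refl => exact ⟨Minion.Hom.id _⟩
  | tail _ h ih => exact ih.trans (homLE_of_edge h)

end Homs

/-! ### The converse: constraints for the minions on the list -/

section Converse

theorem exists_equivalent_of_constraints {k : ℕ} (hk : 0 < k) {M : Minion.{0}}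
    (E Q : Literal k → Literal k → Prop) (h₁ : M.HomLE (constraintMinion k E Q).toMinion)
    (h₂ : (constraintMinion k E Q).toMinion.HomLE M) :
    ∃ (k : ℕ) (_ : 0 < k) (Γ : Set (SortedRelation (boolSorts k))),
      (∀ R ∈ Γ, R.arity ≤ 2) ∧ M.Equivalent (Pol Γ).toMinion := by
  obtain ⟨Γ, hΓ, h⟩ := exists_equivalent_pol E Q
  exact ⟨k, hk, Γ, hΓ, Minion.Equivalent.trans ⟨h₁, h₂⟩ h⟩

theorem exists_equivalent_minionT : ∃ (k : ℕ) (_ : 0 < k) (Γ : Set (SortedRelation (boolSorts k))),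
    (∀ R ∈ Γ, R.arity ≤ 2) ∧ minionT.toMinion.Equivalent (Pol Γ).toMinion :=
  ⟨1, one_pos, ∅, by simp, homLE_of_formula (fun _ _ _ _ => true) (fun _ _ => rfl)
    (fun _ _ _ _ hR => hR.elim), homLE_minionT _⟩

/-- The condition `h_k ≤ dual h_k` is not a constraint between literals. Instead the literal before
the last is required to be `◁` both the last component and its dual; then `h_k ⊓ dual h_k` can serve
as the last component. -/
theorem exists_equivalent_minionA (k : ℕ+) :
    ∃ (k' : ℕ) (_ : 0 < k') (Γ : Set (SortedRelation (boolSorts k'))),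
      (∀ R ∈ Γ, R.arity ≤ 2) ∧ (minionA k).toMinion.Equivalent (Pol Γ).toMinion := by
  refine exists_equivalent_of_constraints k.pos
    (fun v w => (v.1 : ℕ) + 1 = w.1 ∧ v.2 = true ∧ (w.2 = true ∨ (w.1 : ℕ) + 1 = k))
    (fun _ _ => False)
    (homLE_of_formula (fun _ f => f) (fun _ _ => rfl) ?_)
    (homLE_of_formula (fun n f i => if (i : ℕ) + 1 = k then f i ⊓ dual (f i) else f i) ?_ ?_)
  · rintro n f ⟨hf, hf1, hf2⟩
    refine ⟨hf, ?_, fun _ _ => False.elim⟩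
    rintro ⟨i, x⟩ ⟨j, y⟩ ⟨hij, rfl, rfl | hy⟩
    · exact hf1 i j hij
    · cases y
      · exact (hf1 i j hij).trans_le (hf2 j hy)
      · exact hf1 i j hij
  · intro n m α f
    funext i a
    unfold Op.minor
    beta_reduce
    split_ifs <;> rfl
  · rintro n f ⟨hf, hf1, -⟩
    refine ⟨fun i x => ?_, fun i j hij => ?_, fun i hi => ?_⟩
    · dsimp only
      split_ifs
      · simp [dual, hf i _]
      · exact hf i x
    · have := j.2
      beta_reduce
      rw [if_neg (show ¬ (i : ℕ) + 1 = k by omega)]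
      have h1 := hf1 (i, true) (j, true) ⟨hij, rfl, Or.inl rfl⟩
      split_ifs with hj
      · have h2 := hf1 (i, true) (j, false) ⟨hij, rfl, Or.inr hj⟩
        simpa using h1.inf h2
      · exact h1
    · simp only [hi, if_true]
      rw [dual_inf, dual_dual]
      exact inf_le_left.trans le_sup_right

theorem exists_equivalent_minionB (k : ℕ+) :
    ∃ (k' : ℕ) (_ : 0 < k') (Γ : Set (SortedRelation (boolSorts k'))),
      (∀ R ∈ Γ, R.arity ≤ 2) ∧ (minionB k).toMinion.Equivalent (Pol Γ).toMinion := by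
  refine exists_equivalent_of_constraints k.pos
    (fun v w => (v.1 : ℕ) + 1 = w.1 ∧ v.2 = true ∧ w.2 = true ∨
      (v.1 : ℕ) + 1 = k ∧ v.2 = true ∧ w = v.neg)
    (fun _ _ => False)
    (homLE_of_formula (fun _ f => f) (fun _ _ => rfl) ?_)
    (homLE_of_formula (fun _ f => f) (fun _ _ => rfl) ?_)
  · rintro n f ⟨hf, hf1, hf2⟩
    refine ⟨hf, ?_, fun _ _ => False.elim⟩
    rintro ⟨i, x⟩ ⟨j, y⟩ (⟨hij, rfl, rfl⟩ | ⟨hi, rfl, h⟩)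
    · exact hf1 i j hij
    · rw [h]
      exact hf2 i hi
  · rintro n f ⟨hf, hf1, -⟩
    exact ⟨hf, fun i j hij => hf1 (i, true) (j, true) (Or.inl ⟨hij, rfl, rfl⟩),
      fun i hi => hf1 (i, true) (i, false) (Or.inr ⟨hi, rfl, rfl⟩)⟩

theorem exists_equivalent_minionD (k : ℕ+) :
    ∃ (k' : ℕ) (_ : 0 < k') (Γ : Set (SortedRelation (boolSorts k'))),
      (∀ R ∈ Γ, R.arity ≤ 2) ∧ (minionD k).toMinion.Equivalent (Pol Γ).toMinion := by
  refine exists_equivalent_of_constraints k.pos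
    (fun v w => (v.1 : ℕ) + 1 = w.1 ∧ v.2 = true ∧ w.2 = true)
    (fun v w => (v.1 : ℕ) + 1 = k ∧ v.2 = true ∧ w = v.neg)
    (homLE_of_formula (fun _ f => f) (fun _ _ => rfl) ?_)
    (homLE_of_formula (fun _ f => f) (fun _ _ => rfl) ?_)
  · rintro n f ⟨hf, hf1, hf2⟩
    refine ⟨hf, ?_, ?_⟩
    · rintro ⟨i, x⟩ ⟨j, y⟩ ⟨hij, rfl, rfl⟩
      exact hf1 i j hij
    · rintro ⟨i, x⟩ w ⟨hi, rfl, rfl⟩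
      exact hf2 i hi
  · rintro n f ⟨hf, hf1, hf2⟩
    exact ⟨hf, fun i j hij => hf1 (i, true) (j, true) ⟨hij, rfl, rfl⟩,
      fun i hi => hf2 (i, true) (i, false) ⟨hi, rfl, rfl⟩⟩

/-- The link `h_k ≤ h_{k+1}` is omitted from the constraints. It is recovered from `homLE_minionC`,
which constructs a suitable self-dual component from the one present. -/
theorem exists_equivalent_minionC (k : ℕ+) :
    ∃ (k' : ℕ) (_ : 0 < k') (Γ : Set (SortedRelation (boolSorts k'))),
      (∀ R ∈ Γ, R.arity ≤ 2) ∧ (minionC (k + 1)).toMinion.Equivalent (Pol Γ).toMinion := by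
  have hk : ((k + 1 : ℕ+) : ℕ) = k + 1 := PNat.add_coe k 1
  have h1 : ((1 : ℕ+) : ℕ) = 1 := rfl
  refine exists_equivalent_of_constraints (k + 1 : ℕ+).pos
    (fun v w => (v.1 : ℕ) + 1 = w.1 ∧ (w.1 : ℕ) < k ∧ v.2 = true ∧ w.2 = true ∨
      (v.1 : ℕ) + 1 = k ∧ v.2 = true ∧ w = v.neg)
    (fun v w => (v.1 : ℕ) = k ∧ v.2 = true ∧ w = v.neg)
    (homLE_of_formula (fun _ f => f) (fun _ _ => rfl) ?_)
    (homLE_minionC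
      (homLE_of_formula (fun _ f i => f ⟨i, by omega⟩) (fun _ _ => rfl) ?_)
      (homLE_of_formula (fun _ f _ => f ⟨k, by omega⟩) (fun _ _ => rfl) ?_))
  · rintro n f ⟨hf, hf1, hf2, hf3, hf4⟩
    refine ⟨hf, ?_, ?_⟩
    · rintro ⟨i, x⟩ ⟨j, y⟩ (⟨hij, hj, rfl, rfl⟩ | ⟨hi, rfl, h⟩)
      · exact hf1 i j hij (by simp at hj; omega)
      · rw [h]
        exact hf4 i (by simp at hi; omega)
    · rintro ⟨i, x⟩ w ⟨hi, rfl, rfl⟩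
      exact hf3 i (by simp at hi; omega)
  · rintro n f ⟨hf, hf1, -⟩
    exact ⟨fun _ => hf _,
      fun i j hij => hf1 (⟨i, by omega⟩, true) (⟨j, by omega⟩, true)
        (Or.inl ⟨hij, j.2, rfl, rfl⟩),
      fun i hi => hf1 (⟨i, by omega⟩, true) (⟨i, by omega⟩, false) (Or.inr ⟨hi, rfl, rfl⟩)⟩
  · rintro n f ⟨hf, -, hf2⟩
    exact ⟨fun _ => hf _, fun i j hij => by
      have := j.2
      omega, fun i hi => hf2 (⟨k, by omega⟩, true) (⟨k, by omega⟩, false) ⟨rfl, rfl, rfl⟩⟩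

theorem exists_equivalent_minionBinf :
    ∃ (k' : ℕ) (_ : 0 < k') (Γ : Set (SortedRelation (boolSorts k'))),
      (∀ R ∈ Γ, R.arity ≤ 2) ∧ minionBinf.toMinion.Equivalent (Pol Γ).toMinion :=
  exists_equivalent_of_constraints one_pos
    (fun v w => v = (0, true) ∧ (w = (0, true) ∨ w = (0, false))) (fun _ _ => False)
    (homLE_of_formula (fun _ f => f) (fun _ _ => rfl) fun _ _ hf =>
      ⟨hf.1, by rintro _ _ ⟨rfl, rfl | rfl⟩; exacts [hf.2.1, hf.2.2], fun _ _ => False.elim⟩)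
    (homLE_of_formula (fun _ f => f) (fun _ _ => rfl) fun _ _ hf =>
      ⟨hf.1, hf.2.1 (0, true) (0, true) ⟨rfl, Or.inl rfl⟩,
        hf.2.1 (0, true) (0, false) ⟨rfl, Or.inr rfl⟩⟩)

theorem exists_equivalent_minionCinf :
    ∃ (k' : ℕ) (_ : 0 < k') (Γ : Set (SortedRelation (boolSorts k'))),
      (∀ R ∈ Γ, R.arity ≤ 2) ∧ minionCinf.toMinion.Equivalent (Pol Γ).toMinion :=
  exists_equivalent_of_constraints two_pos
    (fun v w => v = (0, true) ∧ (w = (0, true) ∨ w = (1, true)))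
    (fun v w => v = (1, true) ∧ w = (1, false))
    (homLE_of_formula (fun _ f => f) (fun _ _ => rfl) fun _ _ hf =>
      ⟨hf.1, by rintro _ _ ⟨rfl, rfl | rfl⟩; exacts [hf.2.1, hf.2.2.1],
        by rintro _ _ ⟨rfl, rfl⟩; exact hf.2.2.2⟩)
    (homLE_of_formula (fun _ f => f) (fun _ _ => rfl) fun _ _ hf =>
      ⟨hf.1, hf.2.1 (0, true) (0, true) ⟨rfl, Or.inl rfl⟩,
        hf.2.1 (0, true) (1, true) ⟨rfl, Or.inr rfl⟩, hf.2.2 (1, true) (1, false) ⟨rfl, rfl⟩⟩)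

theorem exists_equivalent_minionDinf :
    ∃ (k' : ℕ) (_ : 0 < k') (Γ : Set (SortedRelation (boolSorts k'))),
      (∀ R ∈ Γ, R.arity ≤ 2) ∧ minionDinf.toMinion.Equivalent (Pol Γ).toMinion :=
  exists_equivalent_of_constraints one_pos
    (fun v w => v = (0, true) ∧ w = (0, true)) (fun v w => v = (0, true) ∧ w = (0, false))
    (homLE_of_formula (fun _ f => f) (fun _ _ => rfl) fun _ _ hf =>
      ⟨hf.1, by rintro _ _ ⟨rfl, rfl⟩; exact hf.2.1, by rintro _ _ ⟨rfl, rfl⟩; exact hf.2.2⟩)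
    (homLE_of_formula (fun _ f => f) (fun _ _ => rfl) fun _ _ hf =>
      ⟨hf.1, hf.2.1 (0, true) (0, true) ⟨rfl, rfl⟩, hf.2.2 (0, true) (0, false) ⟨rfl, rfl⟩⟩)

theorem exists_equivalent_listMinion (c : ListIndex) :
    ∃ (k : ℕ) (_ : 0 < k) (Γ : Set (SortedRelation (boolSorts k))),
      (∀ R ∈ Γ, R.arity ≤ 2) ∧ (listMinion c).Equivalent (Pol Γ).toMinion := by
  cases c with
  | T => exact exists_equivalent_minionT
  | A k => exact exists_equivalent_minionA k
  | B k => exact exists_equivalent_minionB k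
  | C k => exact exists_equivalent_minionC k
  | D k => exact exists_equivalent_minionD k
  | Binf => exact exists_equivalent_minionBinf
  | Cinf => exact exists_equivalent_minionCinf
  | Dinf => exact exists_equivalent_minionDinf

end Converse

/-! ### Classification of the minions given by constraints -/

section Full

variable {m : ℕ} {E Q : Literal m → Literal m → Prop}

/-! ### Inference rules for full sets of constraints. -/

theorem constraintMinion_tri {v w : Literal m} (h : E v w) {n : ℕ+}
    {f : Op (boolSorts m) (boolSorts m) n} (hf : f ∈ (constraintMinion m E Q).ops n) :
    Tri (lit f v) (lit f w) := hf.2.1 v w h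

theorem constraintMinion_eq {v w : Literal m} (h : Q v w) {n : ℕ+}
    {f : Op (boolSorts m) (boolSorts m) n} (hf : f ∈ (constraintMinion m E Q).ops n) :
    lit f v = lit f w := hf.2.2 v w h

namespace IsFull

variable (hF : IsFull E Q) {u v w : Literal m}
include hF

theorem trans (h₁ : E u v) (h₂ : E v w) : E u w :=
  hF.tri _ _ fun _ _ hf => (constraintMinion_tri h₁ hf).trans (constraintMinion_tri h₂ hf)

theorem neg (h : E v w) : E w.neg v.neg :=
  hF.tri _ _ fun _ _ hf => by
    rw [lit_neg, lit_neg]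
    exact (constraintMinion_tri h hf).dual

theorem trans_eq (h₁ : E u v) (h₂ : Q v w) : E u w :=
  hF.tri _ _ fun _ _ hf => constraintMinion_eq h₂ hf ▸ constraintMinion_tri h₁ hf

theorem eq_trans (h₁ : Q u v) (h₂ : E v w) : E u w :=
  hF.tri _ _ fun _ _ hf => constraintMinion_eq h₁ hf ▸ constraintMinion_tri h₂ hf

theorem antisymm (h₁ : E v w) (h₂ : E w v) : Q v w :=
  hF.eq _ _ fun _ _ hf =>
    le_antisymm (constraintMinion_tri h₁ hf).le (constraintMinion_tri h₂ hf).le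

theorem eq_refl (v : Literal m) : Q v v := hF.eq _ _ fun _ _ _ => rfl

theorem eq_symm (h : Q v w) : Q w v := hF.eq _ _ fun _ _ hf => (constraintMinion_eq h hf).symm

theorem eq_eq_trans (h₁ : Q u v) (h₂ : Q v w) : Q u w :=
  hF.eq _ _ fun _ _ hf => (constraintMinion_eq h₁ hf).trans (constraintMinion_eq h₂ hf)

theorem eq_neg (h : Q v w) : Q v.neg w.neg :=
  hF.eq _ _ fun _ _ hf => by rw [lit_neg, lit_neg, constraintMinion_eq h hf]

theorem selfDual_congr (h : Q v w) (hv : Q v v.neg) : Q w w.neg :=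
  hF.eq_eq_trans (hF.eq_eq_trans (hF.eq_symm h) hv) (hF.eq_neg h)

end IsFull

/-- A choice of one literal from each pair of opposite literals that are not self-dual, compatible
with the constraints and with a height function. -/
structure IsOrientation (E Q : Literal m → Literal m → Prop) (p : Literal m → ℕ)
    (S : Literal m → Prop) : Prop where
  lower : ∀ v w, E v w → S w → S v
  congr : ∀ v w, Q v w → S w → S v
  total : ∀ v, ¬ Q v v.neg → ¬ S v → S v.neg
  not_both : ∀ v, S v → ¬ S v.neg
  not_selfDual : ∀ v, S v → ¬ Q v v.neg
  below_selfDual : ∀ v w, E v w → Q w w.neg → S v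
  height_le : ∀ v, S v → p v ≤ p v.neg

/-- The literal of smaller height is selected. Ties are broken by a linear extension of inclusion
between the sets of literals below a given one; these sets grow along `E`, and they coincide exactly
for literals equal under `Q`. -/
theorem exists_isOrientation (hF : IsFull E Q) (hE : ∀ v, E v v → ¬ Q v v.neg)
    {p : Literal m → ℕ} (hp : ∀ v w, E v w → p v ≤ p w) (hpQ : ∀ v w, Q v w → p v = p w) :
    ∃ S, IsOrientation E Q p S := by
  classical
  let D : Literal m → Finset (Literal m) := fun v => {u | Q u v ∨ E u v}
  let ψ : Finset (Literal m) → LinearExtension (Finset (Literal m)) := toLinearExtension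
  -- `LinearExtension` is a type synonym, so `ψ` is the identity on underlying sets.
  have hψ : ∀ s t, ψ s = ψ t → s = t := fun _ _ h => h
  have hψle : ∀ s t, s ⊆ t → ψ s ≤ ψ t := fun s t h => toLinearExtension.monotone h
  have hDE : ∀ v w, E v w → D v ⊆ D w := by
    intro v w h u hu
    simp only [D, Finset.mem_filter, Finset.mem_univ, true_and] at hu ⊢
    exact hu.elim (fun hu => Or.inr (hF.eq_trans hu h)) fun hu => Or.inr (hF.trans hu h)
  have hDQ : ∀ v w, Q v w → D v = D w := by
    intro v w h
    ext u
    simp only [D, Finset.mem_filter, Finset.mem_univ, true_and]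
    exact ⟨Or.imp (hF.eq_eq_trans · h) (hF.trans_eq · h),
      Or.imp (hF.eq_eq_trans · (hF.eq_symm h)) (hF.trans_eq · (hF.eq_symm h))⟩
  have hDeq : ∀ v w, D v = D w → Q v w := by
    intro v w h
    have h1 : v ∈ D w := h ▸ by simp [D, hF.eq_refl v]
    have h2 : w ∈ D v := h ▸ by simp [D, hF.eq_refl w]
    simp only [D, Finset.mem_filter, Finset.mem_univ, true_and] at h1 h2
    rcases h1 with h1 | h1
    · exact h1
    · exact h2.elim hF.eq_symm fun h2 => hF.antisymm h1 h2
  refine ⟨fun v => p v < p v.neg ∨ p v = p v.neg ∧ ψ (D v) < ψ (D v.neg),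
    ⟨?_, ?_, ?_, ?_, ?_, ?_, ?_⟩⟩
  · intro v w h hw
    have h1 := hp _ _ h
    have h2 := hp _ _ (hF.neg h)
    rcases hw with hw | ⟨hw, hw'⟩
    · exact Or.inl (by omega)
    · by_cases h3 : p v < p v.neg
      · exact Or.inl h3
      · exact Or.inr ⟨by omega, ((hψle _ _ (hDE _ _ h)).trans_lt hw').trans_le
          (hψle _ _ (hDE _ _ (hF.neg h)))⟩
  · intro v w h hw
    rwa [hpQ _ _ h, hpQ _ _ (hF.eq_neg h), hDQ _ _ h, hDQ _ _ (hF.eq_neg h)]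
  · intro v hv h
    rw [Literal.neg_neg]
    push Not at h
    by_cases h3 : p v.neg < p v
    · exact Or.inl h3
    · have h4 : p v = p v.neg := by omega
      refine Or.inr ⟨h4.symm, lt_of_le_of_ne (h.2 h4) fun heq => hv ?_⟩
      exact hDeq _ _ (hψ _ _ heq).symm
  · intro v h
    rw [Literal.neg_neg]
    rintro (h' | ⟨h', h''⟩) <;> rcases h with h | ⟨h, h'''⟩
    · omega
    · omega
    · omega
    · exact lt_asymm h'' h'''
  · rintro v (h | ⟨-, h⟩) hv
    · rw [hpQ _ _ hv] at h
      exact lt_irrefl _ h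
    · rw [hDQ _ _ hv] at h
      exact lt_irrefl _ h
  · intro v w h hw
    -- For self-dual `w`, `v ◁ w = dual w ◁ dual v`, so `v` precedes its negation. A tie would make
    -- `v` self-dual, whence `w ◁ w`, contrary to `hE`.
    have h1 : E w v.neg := hF.eq_trans hw (hF.neg h)
    have h2 : E v v.neg := hF.trans h h1
    rcases (hp _ _ h2).lt_or_eq with h3 | h3
    · exact Or.inl h3
    · refine Or.inr ⟨h3, lt_of_le_of_ne (hψle _ _ (hDE _ _ h2)) fun heq => ?_⟩
      have hv : Q v v.neg := hDeq _ _ (hψ _ _ heq)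
      exact hE w (hF.trans (hF.trans_eq h1 (hF.eq_symm hv)) h) hw
  · rintro v (h | ⟨h, -⟩) <;> omega

/-- A selected literal is interpreted by the component at its height, the opposite literal by the
dual of that component, and every self-dual literal by the sort `u`. By duality and the properties
of the orientation, `h₁` to `h₄` cover every kind of constraint. -/
theorem homLE_constraintMinion (hF : IsFull E Q) (hE : ∀ v, E v v → ¬ Q v v.neg)
    {p : Literal m → ℕ} (hpQ : ∀ v w, Q v w → p v = p w)
    {S : Literal m → Prop} (hS : IsOrientation E Q p S) {k : ℕ}
    {X : FunctionMinion (boolSorts k) (boolSorts k)} (idx : ℕ → Fin k) (u : Fin k)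
    (hX : ∀ n, ∀ f ∈ X.ops n, f.Idempotent)
    (h₁ : ∀ n, ∀ f ∈ X.ops n, ∀ v w, E v w → S v → S w → Tri (f (idx (p v))) (f (idx (p w))))
    (h₂ : ∀ n, ∀ f ∈ X.ops n, ∀ v w, E v w → S v → S w.neg →
      Tri (f (idx (p v))) (dual (f (idx (p w.neg)))))
    (h₃ : ∀ n, ∀ f ∈ X.ops n, ∀ v w, E v w → S v → Q w w.neg → Tri (f (idx (p v))) (f u))
    (h₄ : ∀ n, ∀ f ∈ X.ops n, ∀ v, Q v v.neg → f u = dual (f u)) :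
    X.toMinion.HomLE (constraintMinion m E Q).toMinion := by
  classical
  let U : ∀ n, Op (boolSorts k) (boolSorts k) n → Literal m → BoolOp n := fun n f v =>
    if Q v v.neg then f u else if S v then f (idx (p v)) else dual (f (idx (p v.neg)))
  have hsd : ∀ v, Q v v.neg → Q v.neg v.neg.neg := fun v hv => hF.eq_neg hv
  have hsd' : ∀ v : Literal m, ¬ Q v v.neg → ¬ Q v.neg v.neg.neg := fun v hv h => by
    rw [Literal.neg_neg] at h
    exact hv (hF.eq_symm h)
  have hU : ∀ n, ∀ f ∈ X.ops n, ∀ v, dual (U n f v) = U n f v.neg := by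
    intro n f hf v
    by_cases hv : Q v v.neg
    · simp only [U, hv, hsd v hv, if_true]
      exact (h₄ n f hf v hv).symm
    · by_cases hSv : S v
      · have hv' := hsd' v hv
        rw [Literal.neg_neg] at hv'
        simp only [U, hv, hv', hSv, hS.not_both v hSv, Literal.neg_neg, if_true, if_false]
        rw [Literal.neg_neg]
      · simp [U, hv, hsd' v hv, hSv, hS.total v hv hSv, dual_dual]
  have hlit : ∀ n, ∀ f ∈ X.ops n, ∀ v,
      lit (fun i => U n f (i, true) : Op (boolSorts m) (boolSorts m) n) v = U n f v := by
    rintro n f hf ⟨i, _ | _⟩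
    · exact hU n f hf (i, true)
    · rfl
  refine homLE_of_formula (fun n f i => U n f (i, true)) ?_ fun n f hf => ⟨fun i x => ?_, ?_, ?_⟩
  · intro n l α f
    funext i a
    unfold Op.minor
    simp only [U]
    split_ifs <;> rfl
  · simp only [U]
    split_ifs
    · exact hX n f hf _ x
    · exact hX n f hf _ x
    · exact apply_const_dual (hX n f hf _)
  · intro v w h
    rw [hlit n f hf, hlit n f hf]
    by_cases hv : Q v v.neg
    · by_cases hw : Q w w.neg
      -- Two self-dual literals are never related: `v ◁ w = dual w ◁ dual v = v` would give `v ◁ v`.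
      · exact absurd hv (hE v (hF.trans_eq (hF.trans h (hF.eq_trans hw (hF.neg h)))
          (hF.eq_symm hv)))
      · have hSw : ¬ S w := fun hSw => hS.not_selfDual v (hS.lower v w h hSw) hv
        have h' : E w.neg v := hF.trans_eq (hF.neg h) (hF.eq_symm hv)
        simp only [U, hv, hw, hSw, if_true, if_false]
        rw [h₄ n f hf v hv]
        exact (h₃ n f hf _ _ h' (hS.total w hw hSw) hv).dual
    · by_cases hw : Q w w.neg
      · have hSv := hS.below_selfDual v w h hw
        simp only [U, hv, hw, hSv, if_true, if_false]
        exact h₃ n f hf _ _ h hSv hw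
      · by_cases hSw : S w
        · have hSv := hS.lower v w h hSw
          simp only [U, hv, hw, hSv, hSw, if_true, if_false]
          exact h₁ n f hf v w h hSv hSw
        · by_cases hSv : S v
          · simp only [U, hv, hw, hSv, hSw, if_true, if_false]
            exact h₂ n f hf v w h hSv (hS.total w hw hSw)
          · simp only [U, hv, hw, hSv, hSw, if_false]
            exact (h₁ n f hf _ _ (hF.neg h) (hS.total w hw hSw) (hS.total v hv hSv)).dual
  · intro v w h
    rw [hlit n f hf, hlit n f hf]
    have e1 : Q v v.neg ↔ Q w w.neg :=
      ⟨hF.selfDual_congr h, hF.selfDual_congr (hF.eq_symm h)⟩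
    have e2 : S v ↔ S w := ⟨hS.congr _ _ (hF.eq_symm h), hS.congr _ _ h⟩
    simp only [U, e1, e2]
    rw [hpQ _ _ h, hpQ _ _ (hF.eq_neg h)]

/-- There is a chain of `n` constraints that ends in the given literal. -/
def HasChain (E : Literal m → Literal m → Prop) : ℕ → Literal m → Prop
  | 0, _ => True
  | n + 1, v => ∃ u, E u v ∧ HasChain E n u

theorem HasChain.exists_seq {n : ℕ} {v : Literal m} (h : HasChain E n v) :
    ∃ c : ℕ → Literal m, c n = v ∧ ∀ i < n, E (c i) (c (i + 1)) := by
  induction n generalizing v with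
  | zero => exact ⟨fun _ => v, rfl, by simp⟩
  | succ n ih =>
    obtain ⟨u, huv, hu⟩ := h
    obtain ⟨c, hc, hc'⟩ := ih hu
    refine ⟨fun i => if i ≤ n then c i else v, by simp, fun i hi => ?_⟩
    rcases Nat.lt_succ_iff_lt_or_eq.1 hi with hi | rfl
    · simpa [hi.le, Nat.succ_le_of_lt hi] using hc' i hi
    · simpa [hc] using huv

/-- By transitivity and irreflexivity the predecessors in a chain are distinct. This bounds the
search for longest chains. -/
theorem HasChain.le_card (hF : IsFull E Q) (hE : ∀ v, ¬ E v v) {n : ℕ} {v : Literal m}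
    (h : HasChain E n v) : n ≤ Fintype.card (Literal m) := by
  classical
  have key : ∃ s : Finset (Literal m), s.card = n ∧ ∀ u ∈ s, E u v := by
    induction n generalizing v with
    | zero => exact ⟨∅, by simp⟩
    | succ n ih =>
      obtain ⟨u, huv, hu⟩ := h
      obtain ⟨s, hs, hsu⟩ := ih hu
      refine ⟨insert u s, ?_, ?_⟩
      · rw [Finset.card_insert_of_notMem fun hmem => hE u (hsu u hmem), hs]
      · intro x hx
        rcases Finset.mem_insert.1 hx with rfl | hx
        · exact huv
        · exact hF.trans (hsu x hx) huv
  obtain ⟨s, hs, -⟩ := key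
  exact hs ▸ s.card_le_univ

/-- A chain that ends in `v.neg`, negated and reversed, is a chain that starts in `v`, so it can be
glued to a chain ending in `v`. -/
theorem HasChain.append (hF : IsFull E Q) {n l : ℕ} {v : Literal m} (h : HasChain E n v)
    (h' : HasChain E l v.neg) : ∃ w, HasChain E (n + l) w := by
  induction l generalizing n v with
  | zero => exact ⟨v, h⟩
  | succ l ih =>
    obtain ⟨u, huv, hu⟩ := h'
    have h1 : E v u.neg := by
      have := hF.neg huv
      rwa [Literal.neg_neg] at this
    obtain ⟨w, hw⟩ := ih (n := n + 1) (v := u.neg) ⟨v, h1, h⟩ (by rwa [Literal.neg_neg])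
    exact ⟨w, by rwa [show n + (l + 1) = n + 1 + l by omega]⟩

/-- `N` is the number of links in a longest chain, and `p v` is this number for chains ending in
`v`. The bound on `p v + p v.neg` is `HasChain.append`; it puts every selected literal in the lower
half of the scale. -/
theorem exists_height (hF : IsFull E Q) (hE : ∀ v, ¬ E v v) (hm : 0 < m) :
    ∃ (N : ℕ) (p : Literal m → ℕ) (c : ℕ → Literal m), (∀ i < N, E (c i) (c (i + 1))) ∧
      (∀ v w, E v w → p v < p w) ∧ (∀ v w, Q v w → p v = p w) ∧ ∀ v, p v + p v.neg ≤ N := by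
  classical
  let M := Fintype.card (Literal m)
  let N := Nat.findGreatest (fun n => ∃ v, HasChain E n v) M
  let p : Literal m → ℕ := fun v => Nat.findGreatest (fun n => HasChain E n v) M
  have hN : ∃ v, HasChain E N v :=
    Nat.findGreatest_spec (P := fun n => ∃ v, HasChain E n v) (Nat.zero_le M)
      ⟨(⟨0, hm⟩, true), trivial⟩
  have hp : ∀ v, HasChain E (p v) v := fun v =>
    Nat.findGreatest_spec (P := fun n => HasChain E n v) (Nat.zero_le M) trivial
  have hle : ∀ n v, HasChain E n v → n ≤ p v := fun n v h =>
    Nat.le_findGreatest (h.le_card hF hE) h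
  have hQ : ∀ v w, Q v w → p v ≤ p w := by
    intro v w h
    refine hle _ _ ?_
    have h1 := hp v
    revert h1
    rcases p v with _ | n
    · exact fun _ => trivial
    · rintro ⟨u, huv, hu⟩
      exact ⟨u, hF.trans_eq huv h, hu⟩
  obtain ⟨v, hv⟩ := hN
  obtain ⟨c, -, hc⟩ := hv.exists_seq
  refine ⟨N, p, c, hc, fun v w h => ?_, fun v w h => ?_, fun v => ?_⟩
  · exact hle _ _ ⟨v, h, hp v⟩
  · exact le_antisymm (hQ _ _ h) (hQ _ _ (hF.eq_symm h))
  · obtain ⟨w, hw⟩ := (hp v).append hF (hp v.neg)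
    exact Nat.le_findGreatest (hw.le_card hF hE) ⟨w, hw⟩

/-! ### Constraint minions compared with the minions on the list. -/

theorem constraintMinion_zero_equivalent_minionT {E Q : Literal 0 → Literal 0 → Prop} :
    (constraintMinion 0 E Q).toMinion.Equivalent minionT.toMinion :=
  ⟨homLE_minionT _, homLE_of_formula (fun _ _ i => i.elim0)
    (fun _ _ => funext fun i => i.elim0) fun _ _ _ =>
      ⟨fun i => i.elim0, fun v => v.1.elim0, fun v => v.1.elim0⟩⟩

theorem inf_dual_const {n : ℕ+} {f g : BoolOp n} (hf : ∀ x : Bool, f (fun _ => x) = x)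
    (hg : ∀ x : Bool, g (fun _ => x) = x) (x : Bool) : (f ⊓ dual g) (fun _ => x) = x := by
  simp [dual, hf, hg]

/-- The chain `c 0, …, c (2k-2)` of odd length is folded at its middle literal. There the fold is `f
⊓ dual f`, which lies below its own dual. -/
theorem constraintMinion_le_minionA {k : ℕ+} {c : ℕ → Literal m}
    (hc : ∀ i, i + 2 < 2 * (k : ℕ) → E (c i) (c (i + 1))) :
    (constraintMinion m E Q).toMinion.HomLE (minionA k).toMinion := by
  refine homLE_of_formula
    (fun n f i => lit f (c i) ⊓ dual (lit f (c (2 * (k : ℕ) - 2 - i)))) ?_ ?_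
  · intro n l α f
    funext i
    simp only [lit_minor]
    rfl
  · intro n f hf
    refine ⟨fun i x => inf_dual_const (lit_const hf.1 _) (lit_const hf.1 _) x,
      fun i j hij => ?_, fun i hi => ?_⟩
    · have := j.2
      have h1 := hf.2.1 _ _ (hc i (by omega))
      have h2 := hf.2.1 _ _ (hc (2 * (k : ℕ) - 2 - j) (by omega))
      rw [show 2 * (k : ℕ) - 2 - j + 1 = 2 * (k : ℕ) - 2 - i by omega] at h2
      rw [hij] at h1
      exact h1.inf h2.dual
    · beta_reduce
      rw [show 2 * (k : ℕ) - 2 - i = i by omega, dual_inf, dual_dual]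
      exact inf_le_left.trans le_sup_right

/-- The chain has an even number `2k` of literals here, so the fold is at the link between `c (k-1)`
and `c k`. This link makes the last component `◁` its dual. -/
theorem constraintMinion_le_minionB {k : ℕ+} {c : ℕ → Literal m}
    (hc : ∀ i, i + 1 < 2 * (k : ℕ) → E (c i) (c (i + 1))) :
    (constraintMinion m E Q).toMinion.HomLE (minionB k).toMinion := by
  refine homLE_of_formula
    (fun n f i => lit f (c i) ⊓ dual (lit f (c (2 * (k : ℕ) - 1 - i)))) ?_ ?_
  · intro n l α f
    funext i
    simp only [lit_minor]
    rfl
  · intro n f hf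
    refine ⟨fun i x => inf_dual_const (lit_const hf.1 _) (lit_const hf.1 _) x,
      fun i j hij => ?_, fun i hi => ?_⟩
    · have := j.2
      have h1 := hf.2.1 _ _ (hc i (by omega))
      have h2 := hf.2.1 _ _ (hc (2 * (k : ℕ) - 1 - j) (by omega))
      rw [show 2 * (k : ℕ) - 1 - j + 1 = 2 * (k : ℕ) - 1 - i by omega] at h2
      rw [hij] at h1
      exact h1.inf h2.dual
    · have h1 := hf.2.1 _ _ (hc i (by omega))
      beta_reduce
      rw [show 2 * (k : ℕ) - 1 - i = i + 1 by omega, dual_inf, dual_dual]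
      exact Tri.le_trans inf_le_left (h1.trans_le le_sup_right)

theorem constraintMinion_le_minionBinf {v : Literal m} (hv : E v v) :
    (constraintMinion m E Q).toMinion.HomLE minionBinf.toMinion := by
  refine homLE_of_formula (fun n f _ => lit f v ⊓ dual (lit f v)) ?_ ?_
  · intro n l α f
    funext i
    simp only [lit_minor]
    rfl
  · intro n f hf
    have h1 := hf.2.1 _ _ hv
    refine ⟨fun i x => inf_dual_const (lit_const hf.1 _) (lit_const hf.1 _) x, h1.inf h1.dual, ?_⟩
    beta_reduce
    rw [dual_inf, dual_dual]
    exact Tri.le_trans inf_le_left (h1.trans_le le_sup_right)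

theorem constraintMinion_le_minionD_one {v : Literal m} (hv : Q v v.neg) :
    (constraintMinion m E Q).toMinion.HomLE (minionD 1).toMinion := by
  have h1 : ((1 : ℕ+) : ℕ) = 1 := rfl
  refine homLE_of_formula (fun n f _ => lit f v) ?_ ?_
  · intro n l α f
    funext i
    simp only [lit_minor]
    rfl
  · intro n f hf
    refine ⟨fun i x => lit_const hf.1 _ x, fun i j hij => ?_, fun _ _ => ?_⟩
    · have := j.2
      omega
    · have := hf.2.2 _ _ hv
      rwa [lit_neg] at this

/-- If one monotone self-dual operation is copied to all sorts, all literals are equal to it, and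
every constraint holds. -/
theorem constraintMinion_equivalent_minionDinf {v : Literal m} (hE : E v v) (hQ : Q v v.neg) :
    (constraintMinion m E Q).toMinion.Equivalent minionDinf.toMinion := by
  constructor
  · refine homLE_of_formula (fun n f _ => lit f v) ?_ ?_
    · intro n l α f
      funext i
      simp only [lit_minor]
      rfl
    · intro n f hf
      refine ⟨fun i x => lit_const hf.1 _ x, hf.2.1 _ _ hE, ?_⟩
      have := hf.2.2 _ _ hQ
      rwa [lit_neg] at this
  · refine homLE_of_formula (fun _ f _ => f 0) (fun _ _ => rfl) fun n f hf => ?_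
    have hlit : ∀ v : Literal m,
        lit (fun _ => f 0 : Op (boolSorts m) (boolSorts m) n) v = f 0 := by
      rintro ⟨i, _ | _⟩
      · exact hf.2.2.symm
      · rfl
    exact ⟨fun _ => hf.1 0, fun v w _ => by rw [hlit, hlit]; exact hf.2.1,
      fun v w _ => by rw [hlit, hlit]⟩

/-- The bound says that `i` and `j` are not both the last sort. For the last component only `≤` to
its dual is available, so one link `◁` of the chain has to be used. -/
theorem tri_dual_of_mem_minionA {k : ℕ+} {n : ℕ+} {f : Op (boolSorts k) (boolSorts k) n}
    (hf : f ∈ (minionA k).ops n) {i j : Fin k} (hij : (i : ℕ) + j + 2 < 2 * (k : ℕ)) :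
    Tri (f i) (dual (f j)) := by
  have hk := k.pos
  have hlt := tri_of_lt (K := k) (fun i j h _ => hf.2.1 i j h)
  let l : Fin k := ⟨k - 1, by omega⟩
  have hl : f l ≤ dual (f l) := hf.2.2 l (by simp [l]; omega)
  have hle : ∀ i : Fin k, f i ≤ f l := by
    intro i
    by_cases h : i = l
    · rw [h]
    · exact (hlt i l (lt_of_le_of_ne (Fin.mk_le_mk.2 (by omega)) h) l.2).le
  by_cases h : i < l
  · exact ((hlt i l h l.2).trans_le hl).trans_le (dual_le_dual (hle j))
  · have h' : (k : ℕ) - 1 ≤ i := not_lt.1 h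
    have hj : j < l := Fin.mk_lt_mk.2 (by omega)
    exact Tri.le_trans ((hle i).trans hl) (hlt j l hj l.2).dual

theorem tri_dual_of_mem_minionB {k : ℕ+} {n : ℕ+} {f : Op (boolSorts k) (boolSorts k) n}
    (hf : f ∈ (minionB k).ops n) (i j : Fin k) : Tri (f i) (dual (f j)) := by
  have hk := k.pos
  have hlt := tri_of_lt (K := k) (fun i j h _ => hf.2.1 i j h)
  let l : Fin k := ⟨k - 1, by omega⟩
  have hl : Tri (f l) (dual (f l)) := hf.2.2 l (by simp [l]; omega)
  have hle : ∀ i : Fin k, f i ≤ f l := by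
    intro i
    by_cases h : i = l
    · rw [h]
    · exact (hlt i l (lt_of_le_of_ne (Fin.mk_le_mk.2 (by omega)) h) l.2).le
  exact (Tri.le_trans (hle i) hl).trans_le (dual_le_dual (hle j))

theorem exists_listMinion_equivalent_constraintMinion (hF : IsFull E Q) :
    ∃ c, (constraintMinion m E Q).toMinion.Equivalent (listMinion c) := by
  rcases Nat.eq_zero_or_pos m with rfl | hm
  · exact ⟨.T, constraintMinion_zero_equivalent_minionT⟩
  by_cases hD : ∃ v, E v v ∧ Q v v.neg
  · obtain ⟨v, hE, hQ⟩ := hD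
    exact ⟨.Dinf, constraintMinion_equivalent_minionDinf hE hQ⟩
  have hE : ∀ v, E v v → ¬ Q v v.neg := fun v h h' => hD ⟨v, h, h'⟩
  by_cases hinf : ∃ v, E v v
  · obtain ⟨v, hv⟩ := hinf
    obtain ⟨S, hS⟩ := exists_isOrientation hF hE (p := fun _ => 0) (fun _ _ _ => le_rfl)
      (fun _ _ _ => rfl)
    have hB := constraintMinion_le_minionBinf (Q := Q) hv
    by_cases hsd : ∃ u, Q u u.neg
    · obtain ⟨u, hu⟩ := hsd
      exact ⟨.Cinf, homLE_minionCinf hB (constraintMinion_le_minionD_one hu),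
        homLE_constraintMinion hF hE (fun _ _ _ => rfl) hS (fun _ => 0) 1 (fun n f hf => hf.1)
          (fun n f hf _ _ _ _ _ => hf.2.1)
          (fun n f hf _ _ _ _ _ => hf.2.2.1.trans (hf.2.2.2 ▸ hf.2.2.1.dual))
          (fun n f hf _ _ _ _ _ => hf.2.2.1) (fun n f hf _ _ => hf.2.2.2)⟩
    · have hsd' := not_exists.1 hsd
      exact ⟨.Binf, hB,
        homLE_constraintMinion hF hE (fun _ _ _ => rfl) hS (fun _ => 0) 0 (fun n f hf => hf.1)
          (fun n f hf _ _ _ _ _ => hf.2.1) (fun n f hf _ _ _ _ _ => hf.2.2)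
          (fun n f hf _ w _ _ h => absurd h (hsd' w)) (fun n f hf v h => absurd h (hsd' v))⟩
  · obtain ⟨N, p, c, hc, hp, hpQ, hpN⟩ := exists_height hF (not_exists.1 hinf) hm
    obtain ⟨S, hS⟩ := exists_isOrientation hF hE (fun v w h => (hp v w h).le) hpQ
    have hpS : ∀ v, S v → 2 * p v ≤ N := fun v hv => by
      have h1 := hpN v
      have h2 := hS.height_le v hv
      omega
    have hpSD : ∀ v, Q v v.neg → 2 * p v ≤ N := fun v hv => by
      have h1 := hpN v
      have h2 := hpQ _ _ hv
      omega
    -- The chain has `N + 1` literals; `k` is half of that number, rounded up.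
    obtain ⟨k, hk⟩ : ∃ k : ℕ+, N + 2 = 2 * (k : ℕ) ∨ N + 1 = 2 * (k : ℕ) := by
      refine ⟨⟨(N + 2) / 2, by omega⟩, ?_⟩
      simp only [PNat.mk_coe]
      omega
    have hk0 := k.pos
    have hidx : ∀ v, S v → p v < k := fun v hv => by
      have := hpS v hv
      omega
    -- The truncation only makes `idx` total: by `hidx`, selected literals have height below `k`.
    let idx : ℕ → Fin k := fun i => ⟨min i (k - 1), by omega⟩
    have hidx' : ∀ v, S v → (idx (p v) : ℕ) = p v := fun v hv => by
      have := hidx v hv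
      simp only [idx]
      omega
    let l : Fin k := ⟨k - 1, by omega⟩
    rcases hk with hk | hk
    · have hA : (constraintMinion m E Q).toMinion.HomLE (minionA k).toMinion :=
        constraintMinion_le_minionA (c := c) fun i hi => hc i (by omega)
      have key₁ : ∀ n, ∀ f ∈ (minionA k).ops n, ∀ v w, E v w → S v → S w →
          Tri (f (idx (p v))) (f (idx (p w))) := fun n f hf v w h hv hw =>
        tri_of_lt (K := k) (fun i j h _ => hf.2.1 i j h) _ _
          (Fin.lt_def.2 (by rw [hidx' v hv, hidx' w hw]; exact hp v w h)) (Fin.is_lt _)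
      have key₂ : ∀ n, ∀ f ∈ (minionA k).ops n, ∀ v w, E v w → S v → S w.neg →
          Tri (f (idx (p v))) (dual (f (idx (p w.neg)))) := fun n f hf v w h hv hw =>
        tri_dual_of_mem_minionA hf (by
          rw [hidx' v hv, hidx' _ hw]
          have h1 := hp v w h
          have h2 := hpN w
          omega)
      by_cases hsd : ∃ u, Q u u.neg
      · obtain ⟨u, hu⟩ := hsd
        have hDA : ∀ n, ∀ f ∈ (minionD k).ops n, f ∈ (minionA k).ops n := fun n f hf =>
          ⟨hf.1, hf.2.1, fun i hi => (hf.2.2 i hi).le⟩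
        refine ⟨.D k, homLE_minionD hA (constraintMinion_le_minionD_one hu),
          homLE_constraintMinion hF hE hpQ hS idx l (fun n f hf => hf.1)
          (fun n f hf => key₁ n f (hDA n f hf)) (fun n f hf => key₂ n f (hDA n f hf))
          (fun n f hf v w h hv hw => ?_) fun n f hf _ _ => hf.2.2 l (by simp [l]; omega)⟩
        refine tri_of_lt (K := k) (fun i j h _ => hf.2.1 i j h) _ _ (Fin.lt_def.2 ?_) (Fin.is_lt _)
        rw [hidx' v hv]
        have h1 := hp v w h
        have h2 := hpSD w hw
        simp only [l]
        omega
      · have hsd' := not_exists.1 hsd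
        exact ⟨.A k, hA, homLE_constraintMinion hF hE hpQ hS idx l (fun n f hf => hf.1) key₁ key₂
          (fun n f hf _ w _ _ h => absurd h (hsd' w)) (fun n f hf v h => absurd h (hsd' v))⟩
    · have hB : (constraintMinion m E Q).toMinion.HomLE (minionB k).toMinion :=
        constraintMinion_le_minionB (c := c) fun i hi => hc i (by omega)
      have key₁ : ∀ n, ∀ f ∈ (minionB k).ops n, ∀ v w, E v w → S v → S w →
          Tri (f (idx (p v))) (f (idx (p w))) := fun n f hf v w h hv hw =>
        tri_of_lt (K := k) (fun i j h _ => hf.2.1 i j h) _ _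
          (Fin.lt_def.2 (by rw [hidx' v hv, hidx' w hw]; exact hp v w h)) (Fin.is_lt _)
      by_cases hsd : ∃ u, Q u u.neg
      · obtain ⟨u, hu⟩ := hsd
        have hk1 : ((k + 1 : ℕ+) : ℕ) = k + 1 := PNat.add_coe k 1
        have hCB : ∀ n, ∀ f ∈ (minionC (k + 1)).ops n,
            (fun i => f ⟨i, by omega⟩ : Op (boolSorts k) (boolSorts k) n) ∈ (minionB k).ops n :=
          fun n f hf => ⟨fun _ => hf.1 _, fun i j hij => hf.2.1 _ _ hij (by simp),
            fun i hi => hf.2.2.2.2 _ (by simp; omega)⟩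
        refine ⟨.C k, homLE_minionC hB (constraintMinion_le_minionD_one hu),
          homLE_constraintMinion hF hE hpQ hS (fun i => ⟨idx i, by omega⟩) ⟨k, by omega⟩
          (fun n f hf => hf.1) (fun n f hf => key₁ n _ (hCB n f hf))
          (fun n f hf v w _ _ _ => tri_dual_of_mem_minionB (hCB n f hf) _ _)
          (fun n f hf v w h hv hw => ?_) fun n f hf _ _ => hf.2.2.2.1 _ (by simp)⟩
        have h1 : Tri (f ⟨idx (p v), by omega⟩) (f ⟨k - 1, by omega⟩) := by
          refine tri_of_lt (K := k) (fun i j h hj => hf.2.1 i j h (by omega)) _ _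
            (Fin.lt_def.2 ?_) (by simp)
          simp only [hidx' v hv]
          have h1 := hp v w h
          have h2 := hpSD w hw
          omega
        exact h1.trans_le (hf.2.2.1 _ _ (by simp; omega) (by simp))
      · have hsd' := not_exists.1 hsd
        exact ⟨.B k, hB, homLE_constraintMinion hF hE hpQ hS idx l (fun n f hf => hf.1) key₁
          (fun n f hf v w _ _ _ => tri_dual_of_mem_minionB hf _ _)
          (fun n f hf _ w _ _ h => absurd h (hsd' w)) (fun n f hf v h => absurd h (hsd' v))⟩

theorem exists_listMinion_equivalent_pol {k : ℕ} (Γ : Set (SortedRelation (boolSorts k)))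
    (hΓ : ∀ R ∈ Γ, R.arity ≤ 2) : ∃ c, (Pol Γ).toMinion.Equivalent (listMinion c) := by
  obtain ⟨m, E, Q, hF, h⟩ := exists_pol_equivalent Γ hΓ
  obtain ⟨c, hc⟩ := exists_listMinion_equivalent_constraintMinion hF
  exact ⟨c, h.trans hc⟩

end Full

/-! ### Binary and ternary operations -/

section BinaryTernary

/-- The tuple `(0, 1)`. -/
def tuple01 : Fin (2 : ℕ+) → Bool := (![false, true] : Fin 2 → Bool)

/-- The tuple `(1, 0)`. -/
def tuple10 : Fin (2 : ℕ+) → Bool := (![true, false] : Fin 2 → Bool)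

theorem tuple_two_cases :
    ∀ a : Fin (2 : ℕ+) → Bool, (∃ x, a = fun _ => x) ∨ a = tuple01 ∨ a = tuple10 := by
  decide

/-- The idempotent binary operation with the values `p` at `(0, 1)` and `q` at `(1, 0)`. -/
def bin (p q : Bool) : BoolOp 2 := fun a =>
  if a (0 : Fin 2) = a (1 : Fin 2) then a (0 : Fin 2) else if a (1 : Fin 2) then p else q

/-- The idempotent ternary operation with the values `p`, `q`, `r`, `s` at `(1, 0, 0)`,
`(0, 1, 1)`, `(1, 1, 0)`, `(0, 0, 1)`, and the value of the first projection elsewhere. -/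
def tern (p q r s : Bool) : BoolOp 3 := fun a =>
  if a (0 : Fin 3) = a (1 : Fin 3) then
    if a (1 : Fin 3) = a (2 : Fin 3) then a (0 : Fin 3) else if a (0 : Fin 3) then r else s
  else if a (1 : Fin 3) = a (2 : Fin 3) then if a (0 : Fin 3) then p else q else a (0 : Fin 3)

/-- The minor map that sends `tern p q r s` to `bin p q`. -/
def mapFst : Fin (3 : ℕ+) → Fin (2 : ℕ+) := (![1, 0, 0] : Fin 3 → Fin 2)

/-- The minor map that sends `tern p q r s` to `bin r s`. -/
def mapSnd : Fin (3 : ℕ+) → Fin (2 : ℕ+) := (![1, 1, 0] : Fin 3 → Fin 2)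

/-- The minor map that exchanges the two arguments. -/
def mapSwap : Fin (2 : ℕ+) → Fin (2 : ℕ+) := (![1, 0] : Fin 2 → Fin 2)

theorem tuple01_comp_le :
    (tuple01 ∘ mapFst : Fin (3 : ℕ+) → Bool) ≤ tuple01 ∘ mapSnd := fun t => by
  revert t
  decide

variable {p q r s p' q' r' s' : Bool}

theorem bin_const (x : Bool) : bin p q (fun _ => x) = x := by
  simp [bin]

theorem tern_const (x : Bool) : tern p q r s (fun _ => x) = x := by
  simp [tern]

theorem dual_tern : dual (tern p q r s) = tern (!q) (!p) (!s) (!r) := by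
  funext a
  simp only [dual, tern]
  rcases Bool.eq_false_or_eq_true (a (0 : Fin 3)) with h0 | h0 <;>
    rcases Bool.eq_false_or_eq_true (a (1 : Fin 3)) with h1 | h1 <;>
    rcases Bool.eq_false_or_eq_true (a (2 : Fin 3)) with h2 | h2 <;> simp [h0, h1, h2]

theorem tern_le (h₁ : p ≤ p') (h₂ : q ≤ q') (h₃ : r ≤ r') (h₄ : s ≤ s') :
    tern p q r s ≤ tern p' q' r' s' := by
  intro a
  simp only [tern]
  cases a (0 : Fin 3) <;> cases a (1 : Fin 3) <;> cases a (2 : Fin 3) <;> simp [*]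

/-- Because `tern` is the first projection at `(1, 0, 1)` and `(0, 1, 0)`, the only conditions from
strict comparabilities are those for `(1, 0, 0) ≤ (1, 1, 0)` and `(0, 0, 1) ≤ (0, 1, 1)`, namely
`h₅` and `h₆`. -/
theorem tri_tern (h₁ : p ≤ p') (h₂ : q ≤ q') (h₃ : r ≤ r') (h₄ : s ≤ s') (h₅ : p ≤ r')
    (h₆ : s ≤ q') : Tri (tern p q r s) (tern p' q' r' s') := by
  intro a b hab
  have h0 := hab (0 : Fin 3)
  have h1 := hab (1 : Fin 3)
  have h2 := hab (2 : Fin 3)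
  simp only [tern]
  revert h0 h1 h2
  cases a (0 : Fin 3) <;> cases a (1 : Fin 3) <;> cases a (2 : Fin 3) <;>
    cases b (0 : Fin 3) <;> cases b (1 : Fin 3) <;> cases b (2 : Fin 3) <;> simp [*]

variable {k : ℕ}

/-- The operation with the components `bin (p i) (q i)`. -/
def binOp (p q : Fin k → Bool) : Op (boolSorts k) (boolSorts k) 2 := fun i => bin (p i) (q i)

/-- The operation with the components `tern (p i) (q i) (r i) (s i)`. -/
def ternOp (p q r s : Fin k → Bool) : Op (boolSorts k) (boolSorts k) 3 :=
  fun i => tern (p i) (q i) (r i) (s i)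

theorem ternOp_minor_fst (p q r s : Fin k → Bool) :
    (ternOp p q r s).minor mapFst = binOp p q := by
  funext i a
  change tern _ _ _ _ (a ∘ mapFst) = bin _ _ a
  simp only [tern, bin, mapFst, Function.comp]
  cases h0 : a (0 : Fin 2) <;> cases h1 : a (1 : Fin 2) <;> simp [h0, h1]

theorem ternOp_minor_snd (p q r s : Fin k → Bool) :
    (ternOp p q r s).minor mapSnd = binOp r s := by
  funext i a
  change tern _ _ _ _ (a ∘ mapSnd) = bin _ _ a
  simp only [tern, bin, mapSnd, Function.comp]
  cases h0 : a (0 : Fin 2) <;> cases h1 : a (1 : Fin 2) <;> simp [h0, h1]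

theorem binOp_minor_swap (p q : Fin k → Bool) : (binOp p q).minor mapSwap = binOp q p := by
  funext i a
  change bin _ _ (a ∘ mapSwap) = bin _ _ a
  simp only [bin, mapSwap, Function.comp]
  cases h0 : a (0 : Fin 2) <;> cases h1 : a (1 : Fin 2) <;> simp [h0, h1]

theorem binOp_tuple01 (p q : Fin k → Bool) (i : Fin k) : binOp p q i tuple01 = p i := by
  simp [binOp, bin, tuple01]

theorem binOp_tuple10 (p q : Fin k → Bool) (i : Fin k) : binOp p q i tuple10 = q i := by
  simp [binOp, bin, tuple10]

theorem op_two_ext {f g : Op (boolSorts k) (boolSorts k) 2} (hf : f.Idempotent)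
    (hg : g.Idempotent) (h₁ : ∀ i, f i tuple01 = g i tuple01)
    (h₂ : ∀ i, f i tuple10 = g i tuple10) : f = g := by
  funext i a
  rcases tuple_two_cases a with ⟨x, rfl⟩ | rfl | rfl
  · rw [hf, hg]
  · exact h₁ i
  · exact h₂ i

theorem eq_binOp {f : Op (boolSorts k) (boolSorts k) 2} (hf : f.Idempotent) :
    f = binOp (fun i => f i tuple01) (fun i => f i tuple10) :=
  op_two_ext hf (fun _ _ => bin_const _)
    (fun i => (binOp_tuple01 (fun i => f i tuple01) (fun i => f i tuple10) i).symm)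
    fun i => (binOp_tuple10 (fun i => f i tuple01) (fun i => f i tuple10) i).symm

theorem minor_swap_tuple01 (f : Op (boolSorts k) (boolSorts k) 2) (i : Fin k) :
    f.minor mapSwap i tuple01 = f i tuple10 :=
  congrArg (f i) (by decide : (tuple01 ∘ mapSwap : Fin (2 : ℕ+) → Bool) = tuple10)

end BinaryTernary

/-! ### Values of homomorphisms at binary operations -/

section ImageValue

variable {k l : ℕ} {X : FunctionMinion (boolSorts k) (boolSorts k)}
  {N : FunctionMinion (boolSorts l) (boolSorts l)}

/-- The operation `binOp p q` belongs to `X`, and the component of the sort `i` of its image under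
`ξ` has the value `1` at `(0, 1)`. -/
def ImageValue (ξ : Minion.Hom X.toMinion N.toMinion) (p q : Fin k → Bool) (i : Fin l) : Prop :=
  ∃ h : binOp p q ∈ X.ops 2, (ξ.app 2 ⟨binOp p q, h⟩).1 i tuple01 = true

theorem hom_minor (ξ : Minion.Hom X.toMinion N.toMinion) {n m : ℕ+}
    {f : Op (boolSorts k) (boolSorts k) n} (hf : f ∈ X.ops n) (α : Fin n → Fin m)
    {g : Op (boolSorts k) (boolSorts k) m} (hg : g ∈ X.ops m) (h : f.minor α = g) :
    (ξ.app m ⟨g, hg⟩).1 = (ξ.app n ⟨f, hf⟩).1.minor α := by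
  subst h
  exact congrArg Subtype.val (ξ.app_map α ⟨f, hf⟩)

variable {ξ : Minion.Hom X.toMinion N.toMinion} {p q r s : Fin k → Bool} {i j : Fin l}

/-- The operation is the second projection, a minor of a unary operation. Its image is then a minor
of an idempotent unary operation, hence again that projection. -/
theorem imageValue_top (hX : ∀ n, ∀ f ∈ X.ops n, f.Idempotent)
    (hN : ∀ n, ∀ f ∈ N.ops n, f.Idempotent)
    (h : binOp (fun _ => true) (fun _ => false) ∈ X.ops 2) (i : Fin l) :
    ImageValue ξ (fun _ => true) (fun _ => false) i := by
  refine ⟨h, ?_⟩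
  have hu := X.minor_mem (m := 1) _ (fun _ => (0 : Fin 1)) h
  have heq : ((binOp (fun _ => true) (fun _ => false)).minor
      (m := 1) (fun _ => (0 : Fin 1))).minor (m := 2) (fun _ => (1 : Fin 2)) =
      (binOp (fun _ => true) (fun _ => false) : Op (boolSorts k) (boolSorts k) 2) := by
    refine op_two_ext (fun i x => ?_) (hX _ _ h) (fun i => ?_) fun i => ?_
    · exact hX _ _ h i x
    · rw [binOp_tuple01]
      exact hX _ _ h i true
    · rw [binOp_tuple10]
      exact hX _ _ h i false
  rw [hom_minor (m := 2) ξ hu (fun _ => (1 : Fin 2)) h heq]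
  exact hN _ _ (ξ.app 1 ⟨_, hu⟩).2 i true

/-- The two binary operations are minors of one ternary operation. The tuple `(0, 1)` pulls back to
`(1, 0, 0)` and `(1, 1, 0)`, which are comparable, so `◁` in the target carries the value over. -/
theorem ImageValue.step (h : ImageValue ξ p q i) (hz : ternOp p q r s ∈ X.ops 3)
    (hN : ∀ z ∈ N.ops 3, Tri (z i) (z j)) : ImageValue ξ r s j := by
  have h2 : binOp r s ∈ X.ops 2 := ternOp_minor_snd p q r s ▸ X.minor_mem _ mapSnd hz
  obtain ⟨h1, h⟩ := h
  refine ⟨h2, ?_⟩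
  rw [hom_minor ξ hz mapFst h1 (ternOp_minor_fst p q r s)] at h
  rw [hom_minor ξ hz mapSnd h2 (ternOp_minor_snd p q r s)]
  exact (hN _ (ξ.app 3 ⟨_, hz⟩).2 (tuple01 ∘ mapFst) (tuple01 ∘ mapSnd)
    tuple01_comp_le) h

/-- Dualizing the target component negates `(1, 1, 0)` to `(0, 0, 1)`. The value excluded is
therefore that of the second minor at `(1, 0)`, which is the value at `(0, 1)` after a swap. -/
theorem ImageValue.not_step (h : ImageValue ξ p q i) (hz : ternOp p q r s ∈ X.ops 3)
    (hN : ∀ z ∈ N.ops 3, Tri (z i) (dual (z j))) : ¬ ImageValue ξ s r j := by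
  rintro ⟨h2, h'⟩
  have h3 : binOp r s ∈ X.ops 2 := ternOp_minor_snd p q r s ▸ X.minor_mem _ mapSnd hz
  obtain ⟨h1, h⟩ := h
  rw [hom_minor ξ hz mapFst h1 (ternOp_minor_fst p q r s)] at h
  rw [hom_minor ξ h3 mapSwap h2 (binOp_minor_swap r s), minor_swap_tuple01,
    hom_minor ξ hz mapSnd h3 (ternOp_minor_snd p q r s)] at h'
  have := (hN _ (ξ.app 3 ⟨_, hz⟩).2 (tuple01 ∘ mapFst) (tuple01 ∘ mapSnd)
    tuple01_comp_le) h
  simp only [dual, Bool.not_eq_true'] at this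
  have heq : (fun t => !((tuple01 ∘ mapSnd) t)) = tuple10 ∘ mapSnd := by decide
  rw [heq] at this
  exact Bool.false_ne_true (this.symm.trans h')

theorem ImageValue.mono (h : ImageValue ξ p q i) (hN : ∀ z ∈ N.ops 2, z i ≤ z j) :
    ImageValue ξ p q j :=
  ⟨h.1, hN _ (ξ.app 2 ⟨_, h.1⟩).2 tuple01 h.2⟩

theorem app_binOp_tuple10 (hpq : binOp p q ∈ X.ops 2) (hqp : binOp q p ∈ X.ops 2) :
    (ξ.app 2 ⟨binOp p q, hpq⟩).1 i tuple10 = (ξ.app 2 ⟨binOp q p, hqp⟩).1 i tuple01 := by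
  rw [hom_minor ξ hpq mapSwap hqp (binOp_minor_swap p q), minor_swap_tuple01]

theorem swap_mem (hpq : binOp p q ∈ X.ops 2) : binOp q p ∈ X.ops 2 :=
  binOp_minor_swap p q ▸ X.minor_mem _ mapSwap hpq

theorem dual_tuple01 {f : BoolOp 2} : dual f tuple01 = !(f tuple10) := by
  have : (fun t => !(tuple01 t)) = tuple10 := by decide
  simp only [dual, this]

theorem ImageValue.not_swap (h : ImageValue ξ p q i) (hN : ∀ z ∈ N.ops 2, z i ≤ dual (z i)) :
    ¬ ImageValue ξ q p i := by
  rintro ⟨h2, h'⟩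
  obtain ⟨h1, h⟩ := h
  have := hN _ (ξ.app 2 ⟨_, h1⟩).2 tuple01 h
  rw [dual_tuple01, app_binOp_tuple10 h1 h2, h'] at this
  exact Bool.false_ne_true this

theorem imageValue_swap_iff (hpq : binOp p q ∈ X.ops 2)
    (hN : ∀ z ∈ N.ops 2, z i = dual (z i)) : ImageValue ξ q p i ↔ ¬ ImageValue ξ p q i := by
  refine ⟨fun h => h.not_swap fun z hz => (hN z hz).le, fun h => ⟨swap_mem hpq, ?_⟩⟩
  by_contra h'
  refine h ⟨hpq, ?_⟩
  rw [hN _ (ξ.app 2 ⟨_, hpq⟩).2, dual_tuple01, app_binOp_tuple10 hpq (swap_mem hpq)]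
  simpa using h'

/-- The function with the value `1` at the sorts from `j` on. -/
def upper (j : ℕ) : Fin k → Bool := fun i => decide (j ≤ (i : ℕ))

/-- The constant function with the value `0`. -/
def zeros : Fin k → Bool := fun _ => false

theorem upper_zero : (upper 0 : Fin k → Bool) = fun _ => true := by
  funext i
  simp [upper]

/-- Starting from the projection `binOp (upper 0) zeros`, each step removes the lowest sort from
`upper` and moves one link up the chain of the target. -/
theorem imageValue_upper (hX : ∀ n, ∀ f ∈ X.ops n, f.Idempotent)
    (hN : ∀ n, ∀ f ∈ N.ops n, f.Idempotent) (htop : binOp (upper 0) zeros ∈ X.ops 2) {K : ℕ}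
    (hN' : ∀ z ∈ N.ops 3, ∀ i j : Fin l, (i : ℕ) + 1 = j → (j : ℕ) < K → Tri (z i) (z j))
    {L : ℕ} (hstep : ∀ j < L, ternOp (upper j) zeros (upper (j + 1)) zeros ∈ X.ops 3) (i : Fin l)
    (hi : (i : ℕ) < K) (hL : (i : ℕ) ≤ L) : ImageValue ξ (upper i) zeros i := by
  obtain ⟨i, hil⟩ := i
  induction i with
  | zero =>
    have := imageValue_top (ξ := ξ) hX hN (by rw [← upper_zero]; exact htop) ⟨0, hil⟩
    rw [← upper_zero] at this
    exact this
  | succ i ih =>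
    exact (ih (by omega) (Nat.lt_of_succ_lt hi) (Nat.le_of_succ_le hL)).step (hstep i hL)
      fun z hz => hN' z hz _ _ rfl hi

theorem ImageValue.upper_shift {K L : ℕ}
    (hN' : ∀ z ∈ N.ops 3, ∀ i j : Fin l, (i : ℕ) + 1 = j → (j : ℕ) < K → Tri (z i) (z j))
    (hstep : ∀ j < L, ternOp (upper j) zeros (upper (j + 1)) zeros ∈ X.ops 3) {j : ℕ}
    (h : ImageValue ξ (upper j) zeros i) (d : ℕ) (hd : j + d ≤ L) (i' : Fin l)
    (hi' : (i' : ℕ) = i + d) (hK : (i' : ℕ) < K) : ImageValue ξ (upper (j + d)) zeros i' := by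
  induction d generalizing i' with
  | zero =>
    obtain rfl : i' = i := Fin.ext hi'
    exact h
  | succ d ih =>
    have := i'.2
    exact (ih (by omega) ⟨i + d, by omega⟩ rfl (by simp; omega)).step (hstep (j + d) hd)
      fun z hz => hN' z hz _ _ hi'.symm hK

end ImageValue

/-! ### Some ternary members of the minions on the list -/

section Members

variable {k : ℕ+}

theorem ternOp_idempotent {k : ℕ} (p q r s : Fin k → Bool) : (ternOp p q r s).Idempotent :=
  fun _ _ => tern_const _

theorem binOp_mem_of_ternOp_mem {k : ℕ} {X : FunctionMinion (boolSorts k) (boolSorts k)}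
    {p q r s : Fin k → Bool} (h : ternOp p q r s ∈ X.ops 3) : binOp p q ∈ X.ops 2 :=
  ternOp_minor_fst p q r s ▸ X.minor_mem _ mapFst h

theorem binOp_upper_zero_mem {k : ℕ} {X : FunctionMinion (boolSorts k) (boolSorts k)}
    (hX : ∀ n, ∀ f ∈ X.ops n, f.Idempotent) : binOp (upper 0) zeros ∈ X.ops 2 := by
  obtain ⟨n, f, hf⟩ := X.nonempty
  have h := X.minor_mem f (m := 2) (fun _ => (1 : Fin 2)) hf
  convert h using 1
  refine op_two_ext (fun _ _ => bin_const _) (hX _ _ h) (fun i => ?_) fun i => ?_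
  · rw [binOp_tuple01, upper_zero]
    exact (hX _ f hf i true).symm
  · rw [binOp_tuple10]
    exact (hX _ f hf i false).symm

theorem upper_step_mem_minionD (j : ℕ) (hj : j + 1 < k) :
    ternOp (upper j) zeros (upper (j + 1)) zeros ∈ (minionD k).ops 3 := by
  refine ⟨ternOp_idempotent _ _ _ _, fun i i' hi => ?_, fun i hi => ?_⟩
  · refine tri_tern ?_ le_rfl ?_ le_rfl ?_ le_rfl <;> simp only [upper, Bool.le_iff_imp,
      decide_eq_true_eq] <;> omega
  · have h1 : j ≤ i := by omega
    have h2 : j + 1 ≤ i := by omega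
    simp only [ternOp, dual_tern, upper, zeros, h1, h2, decide_true, Bool.not_false, Bool.not_true]

theorem upper_flip_mem_minionD :
    ternOp (upper (k - 1)) zeros zeros (upper (k - 1)) ∈ (minionD k).ops 3 := by
  refine ⟨ternOp_idempotent _ _ _ _, fun i i' hi => ?_, fun i hi => ?_⟩
  · have := i'.2
    have h1 : ¬ (k : ℕ) - 1 ≤ i := by omega
    refine tri_tern ?_ ?_ ?_ ?_ ?_ ?_ <;> simp [upper, zeros, h1]
  · have h1 : (k : ℕ) - 1 ≤ i := by omega
    simp only [ternOp, dual_tern, upper, zeros, h1, decide_true, Bool.not_false, Bool.not_true]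

theorem upper_step_mem_minionB (j : ℕ) :
    ternOp (upper j) zeros (upper (j + 1)) zeros ∈ (minionB k).ops 3 := by
  refine ⟨ternOp_idempotent _ _ _ _, fun i i' hi => ?_, fun i hi => ?_⟩
  · refine tri_tern ?_ le_rfl ?_ le_rfl ?_ le_rfl <;> simp only [upper, Bool.le_iff_imp,
      decide_eq_true_eq] <;> omega
  · simp only [ternOp, dual_tern]
    refine tri_tern ?_ ?_ ?_ ?_ ?_ ?_ <;> simp [zeros]

theorem upper_step_mem_minionC (j : ℕ) (hj : j < k) :
    ternOp (upper j) zeros (upper (j + 1)) zeros ∈ (minionC (k + 1)).ops 3 := by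
  have hk : ((k + 1 : ℕ+) : ℕ) = k + 1 := PNat.add_coe k 1
  refine ⟨ternOp_idempotent _ _ _ _, fun i i' hi _ => ?_, fun i i' hi _ => ?_, fun i hi => ?_,
    fun i hi => ?_⟩
  · refine tri_tern ?_ le_rfl ?_ le_rfl ?_ le_rfl <;> simp only [upper, Bool.le_iff_imp,
      decide_eq_true_eq] <;> omega
  · refine tern_le ?_ le_rfl ?_ le_rfl <;> simp only [upper, Bool.le_iff_imp,
      decide_eq_true_eq] <;> omega
  · have h1 : j ≤ i := by omega
    have h2 : j + 1 ≤ i := by omega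
    simp only [ternOp, dual_tern, upper, zeros, h1, h2, decide_true, Bool.not_false, Bool.not_true]
  · simp only [ternOp, dual_tern]
    refine tri_tern ?_ ?_ ?_ ?_ ?_ ?_ <;> simp [zeros]

theorem upper_flip_mem_minionC (j : ℕ) (hj : j = (k : ℕ) - 1 ∨ j = k) :
    ternOp (upper j) zeros zeros (upper k) ∈ (minionC (k + 1)).ops 3 := by
  have hk : ((k + 1 : ℕ+) : ℕ) = k + 1 := PNat.add_coe k 1
  refine ⟨ternOp_idempotent _ _ _ _, fun i i' hi hi' => ?_, fun i i' hi hi' => ?_, fun i hi => ?_,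
    fun i hi => ?_⟩
  · have h1 : ¬ (k : ℕ) ≤ i := by omega
    have h2 : ¬ j ≤ i := by omega
    refine tri_tern ?_ ?_ ?_ ?_ ?_ ?_ <;> simp [upper, zeros, h1, h2]
  · have h1 : ¬ (k : ℕ) ≤ i := by omega
    have h2 : j ≤ i' := by omega
    refine tern_le ?_ ?_ ?_ ?_ <;> simp [upper, zeros, h1, h2]
  · have h1 : (k : ℕ) ≤ i := by omega
    have h2 : j ≤ i := by omega
    simp only [ternOp, dual_tern, upper, zeros, h1, h2, decide_true, Bool.not_false, Bool.not_true]
  · have h1 : ¬ (k : ℕ) ≤ i := by omega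
    simp only [ternOp, dual_tern]
    refine tri_tern ?_ ?_ ?_ ?_ ?_ ?_ <;> simp [upper, zeros, h1]

theorem lower_flip_mem_minionC :
    ternOp zeros (upper k) (upper k) zeros ∈ (minionC (k + 1)).ops 3 := by
  have hk : ((k + 1 : ℕ+) : ℕ) = k + 1 := PNat.add_coe k 1
  refine ⟨ternOp_idempotent _ _ _ _, fun i i' hi hi' => ?_, fun i i' hi hi' => ?_, fun i hi => ?_,
    fun i hi => ?_⟩
  · have h1 : ¬ (k : ℕ) ≤ i := by omega
    refine tri_tern ?_ ?_ ?_ ?_ ?_ ?_ <;> simp [upper, zeros, h1]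
  · have h1 : ¬ (k : ℕ) ≤ i := by omega
    refine tern_le ?_ ?_ ?_ ?_ <;> simp [upper, zeros, h1]
  · have h1 : (k : ℕ) ≤ i := by omega
    simp only [ternOp, dual_tern, upper, zeros, h1, decide_true, Bool.not_false, Bool.not_true]
  · have h1 : ¬ (k : ℕ) ≤ i := by omega
    simp only [ternOp, dual_tern]
    refine tri_tern ?_ ?_ ?_ ?_ ?_ ?_ <;> simp [upper, zeros, h1]

theorem upper_flip_mem_minionCinf :
    ternOp (upper 1) zeros zeros (upper 1) ∈ minionCinf.ops 3 := by
  refine ⟨ternOp_idempotent _ _ _ _, ?_, ?_, ?_⟩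
  · refine tri_tern ?_ ?_ ?_ ?_ ?_ ?_ <;> simp [upper, zeros]
  · refine tri_tern ?_ ?_ ?_ ?_ ?_ ?_ <;> simp [upper, zeros]
  · simp only [ternOp, dual_tern]
    rfl

theorem lower_flip_mem_minionCinf :
    ternOp zeros (upper 1) (upper 1) zeros ∈ minionCinf.ops 3 := by
  refine ⟨ternOp_idempotent _ _ _ _, ?_, ?_, ?_⟩
  · refine tri_tern ?_ ?_ ?_ ?_ ?_ ?_ <;> simp [upper, zeros]
  · refine tri_tern ?_ ?_ ?_ ?_ ?_ ?_ <;> simp [upper, zeros]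
  · simp only [ternOp, dual_tern]
    rfl

end Members

/-! ### Nonexistence of homomorphisms -/

section Separation

/-- The binary element of `T` is invariant under the swap and is a minor of a unary element. Its
image would be a projection invariant under the swap. -/
theorem not_minionT_le_minionA_one : ¬ minionT.toMinion.HomLE (minionA 1).toMinion := by
  rintro ⟨ξ⟩
  let t : minionT.toMinion.obj 2 := ⟨fun _ _ => (), trivial⟩
  have h := ξ.app_map (n := 2) (m := 2) mapSwap t
  have ht := ξ.app_map (n := 2) (m := 2) (fun _ => (1 : Fin 2)) t
  have h1 : minionT.toMinion.map mapSwap t = t := rfl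
  have h2 : minionT.toMinion.map (n := 2) (m := 2) (fun _ => (1 : Fin 2)) t = t := rfl
  rw [h1] at h
  rw [h2] at ht
  have hid := (ξ.app 2 t).2.1
  have e1 : (ξ.app 2 t).1 0 tuple01 = true := by
    rw [ht]
    exact hid 0 true
  have e2 : (ξ.app 2 t).1 0 tuple01 = false := by
    rw [h]
    refine (minor_swap_tuple01 _ _).trans ?_
    rw [ht]
    exact hid 0 false
  exact Bool.false_ne_true (e2.symm.trans e1)

/-- `B_∞` contains the symmetric binary minimum, and no self-dual binary operation is symmetric. -/
theorem not_minionBinf_le_minionD_one : ¬ minionBinf.toMinion.HomLE (minionD 1).toMinion := by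
  rintro ⟨ξ⟩
  have hmem : ternOp zeros zeros zeros zeros ∈ minionBinf.ops 3 := by
    refine ⟨ternOp_idempotent _ _ _ _, ?_, ?_⟩
    · refine tri_tern ?_ ?_ ?_ ?_ ?_ ?_ <;> simp [zeros]
    · simp only [ternOp, dual_tern]
      refine tri_tern ?_ ?_ ?_ ?_ ?_ ?_ <;> simp [zeros]
  have := imageValue_swap_iff (ξ := ξ) (i := 0) (binOp_mem_of_ternOp_mem hmem)
    fun z hz => hz.2.2 0 rfl
  exact iff_not_self this

/-- Two ternary members link `binOp (upper 1) zeros` to its swap in either direction. A monotone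
self-dual image would have the same value at `(0, 1)` on both, whereas self-duality makes these
values opposite. -/
theorem not_minionCinf_le_minionDinf : ¬ minionCinf.toMinion.HomLE minionDinf.toMinion := by
  rintro ⟨ξ⟩
  have key := imageValue_swap_iff (ξ := ξ) (i := 0)
    (binOp_mem_of_ternOp_mem upper_flip_mem_minionCinf) fun z hz => hz.2.2
  by_cases h : ImageValue ξ (upper 1) zeros 0
  · exact key.1 (h.step upper_flip_mem_minionCinf fun z hz => hz.2.1) h
  · exact h ((key.2 h).step lower_flip_mem_minionCinf fun z hz => hz.2.1)

/-- The steps along the chain reach the last sort with `binOp (upper (k-1)) zeros`. One more ternary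
member leads from there to the swap of the same operation, which the last link `h_k ◁ dual h_k` of
`B_k` forbids. -/
theorem not_minionD_le_minionB (k : ℕ+) : ¬ (minionD k).toMinion.HomLE (minionB k).toMinion := by
  rintro ⟨ξ⟩
  have hk := k.pos
  have h := imageValue_upper (X := minionD k) (N := minionB k) (ξ := ξ) (fun n f hf => hf.1) (fun n f hf => hf.1)
    (binOp_upper_zero_mem fun n f hf => hf.1) (K := k)
    (fun z hz i j hij _ => hz.2.1 i j hij) (L := k - 1)
    (fun j hj => upper_step_mem_minionD j (by omega)) ⟨k - 1, by omega⟩ (by simp) le_rfl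
  exact h.not_step upper_flip_mem_minionD (fun z hz => hz.2.2 _ (by simp; omega)) h

/-- `C_{k+1}` allows all the steps to the last sort of `A_{k+1}`, giving the value `1` for `binOp
(upper k) zeros`. Using the flip in the last step gives the value `1` for the swapped operation too,
contrary to `h ≤ dual h` there. -/
theorem not_minionC_le_minionA (k : ℕ+) :
    ¬ (minionC (k + 1)).toMinion.HomLE (minionA (k + 1)).toMinion := by
  rintro ⟨ξ⟩
  have hk0 := k.pos
  have hk : ((k + 1 : ℕ+) : ℕ) = k + 1 := PNat.add_coe k 1
  have hN : ∀ z ∈ (minionA (k + 1)).ops 3, ∀ i j : Fin (k + 1 : ℕ+), (i : ℕ) + 1 = j →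
      (j : ℕ) < k + 1 → Tri (z i) (z j) := fun z hz i j hij _ => hz.2.1 i j hij
  have h : ∀ i : Fin (k + 1 : ℕ+), ImageValue ξ (upper i) zeros i := fun i =>
    imageValue_upper (X := minionC (k + 1)) (N := minionA (k + 1)) (fun n f hf => hf.1) (fun n f hf => hf.1)
      (binOp_upper_zero_mem fun n f hf => hf.1) hN (L := k) upper_step_mem_minionC i
      (by omega) (by omega)
  have h1 := h ⟨k - 1, by omega⟩
  have h2 : ImageValue ξ zeros (upper k) ⟨k, by omega⟩ :=
    h1.step (upper_flip_mem_minionC _ (Or.inl rfl)) fun z hz => hN z hz _ _ (by simp; omega)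
      (by simp)
  exact (h ⟨k, by omega⟩).not_swap (fun z hz => hz.2.2 _ (by simp)) h2

end Separation

/-! ### The order on the list -/

section Order

open ListIndex

/-- The length of the longest chain `h_1 ◁ … ◁ h_n` of components and their duals in a minion on
the list. -/
def ListIndex.level : ListIndex → ℕ∞
  | T => 0
  | A k => ((2 * k - 1 : ℕ) : ℕ∞)
  | B k => ((2 * k : ℕ) : ℕ∞)
  | C k => ((2 * k : ℕ) : ℕ∞)
  | D k => ((2 * k - 1 : ℕ) : ℕ∞)
  | Binf => ⊤
  | Cinf => ⊤
  | Dinf => ⊤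

/-- This is `0` if no component is self-dual, `2` if there is a monotone self-dual component, and
`1` otherwise. -/
def ListIndex.duality : ListIndex → ℕ
  | T => 0
  | A _ => 0
  | B _ => 0
  | C _ => 1
  | D _ => 1
  | Binf => 0
  | Cinf => 1
  | Dinf => 2

/-! ### The diagram in terms of the invariants `level` and `duality`. -/

theorem Edge.diagramLE {c d : ListIndex} (h : Edge c d) : DiagramLE c d :=
  Relation.ReflTransGen.single h

theorem DiagramLE.trans {b c d : ListIndex} (h₁ : DiagramLE b c) (h₂ : DiagramLE c d) :
    DiagramLE b d := Relation.ReflTransGen.trans h₁ h₂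

theorem diagramLE_A {k l : ℕ+} (h : (k : ℕ) ≤ l) : DiagramLE (A l) (A k) := by
  obtain ⟨d, hd⟩ := Nat.exists_eq_add_of_le h
  clear h
  induction d generalizing k with
  | zero =>
    obtain rfl : l = k := PNat.eq hd
    exact Relation.ReflTransGen.refl
  | succ d ih =>
    exact (ih (k := k + 1) (by rw [PNat.add_coe, PNat.one_coe]; omega)).trans
      ((Edge.A_B k).diagramLE.trans (Edge.B_A k).diagramLE)

theorem diagramLE_D {k l : ℕ+} (h : (k : ℕ) ≤ l) : DiagramLE (D l) (D k) := by
  obtain ⟨d, hd⟩ := Nat.exists_eq_add_of_le h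
  clear h
  induction d generalizing k with
  | zero =>
    obtain rfl : l = k := PNat.eq hd
    exact Relation.ReflTransGen.refl
  | succ d ih =>
    exact (ih (k := k + 1) (by rw [PNat.add_coe, PNat.one_coe]; omega)).trans
      ((Edge.D_C k).diagramLE.trans (Edge.C_D k).diagramLE)

theorem diagramLE_A_B {k l : ℕ+} (h : (k : ℕ) < l) : DiagramLE (A l) (B k) :=
  (diagramLE_A (k := k + 1) (by rw [PNat.add_coe, PNat.one_coe]; omega)).trans
    (Edge.A_B k).diagramLE

theorem diagramLE_D_C {k l : ℕ+} (h : (k : ℕ) < l) : DiagramLE (D l) (C k) :=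
  (diagramLE_D (k := k + 1) (by rw [PNat.add_coe, PNat.one_coe]; omega)).trans
    (Edge.D_C k).diagramLE

theorem diagramLE_B {k l : ℕ+} (h : (k : ℕ) ≤ l) : DiagramLE (B l) (B k) := by
  rcases h.lt_or_eq with h | h
  · exact (Edge.B_A l).diagramLE.trans (diagramLE_A_B h)
  · obtain rfl := PNat.eq h
    exact Relation.ReflTransGen.refl

theorem diagramLE_C {k l : ℕ+} (h : (k : ℕ) ≤ l) : DiagramLE (C l) (C k) := by
  rcases h.lt_or_eq with h | h
  · exact (Edge.C_D l).diagramLE.trans (diagramLE_D_C h)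
  · obtain rfl := PNat.eq h
    exact Relation.ReflTransGen.refl

theorem diagramLE_A_T (k : ℕ+) : DiagramLE (A k) T :=
  (diagramLE_A (k := 1) k.pos).trans Edge.A_T.diagramLE

theorem diagramLE_of_duality_eq_zero {c d : ListIndex} (hc : c.duality = 0) (hd : d.duality = 0)
    (h : d.level ≤ c.level) : DiagramLE c d := by
  rcases c with _ | l | l | l | l | _ | _ | _ <;> rcases d with _ | k | k | k | k | _ | _ | _ <;>
    simp only [duality, level, Nat.cast_le, one_ne_zero, OfNat.ofNat_ne_zero, top_le_iff,
      ENat.natCast_ne_top, nonpos_iff_eq_zero, Nat.cast_eq_zero] at hc hd h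
  · exact Relation.ReflTransGen.refl
  · have := k.pos
    omega
  · have := k.pos
    omega
  · exact absurd h ENat.top_ne_zero
  · exact diagramLE_A_T l
  · have := k.pos
    exact diagramLE_A (by omega)
  · have := k.pos
    exact diagramLE_A_B (by omega)
  · exact (Edge.B_A l).diagramLE.trans (diagramLE_A_T l)
  · exact (Edge.B_A l).diagramLE.trans (diagramLE_A (by omega))
  · exact diagramLE_B (by omega)
  · exact (Edge.Binf_B 1).diagramLE.trans ((Edge.B_A 1).diagramLE.trans (diagramLE_A_T 1))
  · exact (Edge.Binf_B k).diagramLE.trans (Edge.B_A k).diagramLE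
  · exact (Edge.Binf_B k).diagramLE
  · exact Relation.ReflTransGen.refl

theorem diagramLE_of_duality_eq_one {c d : ListIndex} (hc : c.duality = 1) (hd : d.duality = 1)
    (h : d.level ≤ c.level) : DiagramLE c d := by
  rcases c with _ | l | l | l | l | _ | _ | _ <;> rcases d with _ | k | k | k | k | _ | _ | _ <;>
    simp only [duality, level, Nat.cast_le, zero_ne_one, OfNat.ofNat_ne_one, top_le_iff,
      ENat.natCast_ne_top] at hc hd h
  · exact diagramLE_C (by omega)
  · exact (Edge.C_D l).diagramLE.trans (diagramLE_D (by omega))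
  · have := k.pos
    exact diagramLE_D_C (by omega)
  · have := k.pos
    exact diagramLE_D (by omega)
  · exact (Edge.Cinf_C k).diagramLE
  · exact (Edge.Cinf_C k).diagramLE.trans (Edge.C_D k).diagramLE
  · exact Relation.ReflTransGen.refl

theorem exists_edge_of_duality_eq_one {c : ListIndex} (hc : c.duality = 1) :
    ∃ b, Edge c b ∧ b.duality = 0 ∧ b.level = c.level := by
  rcases c with _ | l | l | l | l | _ | _ | _ <;>
    simp only [duality, zero_ne_one, OfNat.ofNat_ne_one] at hc
  · exact ⟨B l, Edge.C_B l, rfl, rfl⟩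
  · exact ⟨A l, Edge.D_A l, rfl, rfl⟩
  · exact ⟨Binf, Edge.Cinf_Binf, rfl, rfl⟩

theorem eq_Dinf_of_duality {c : ListIndex} (hc : 2 ≤ c.duality) : c = Dinf := by
  cases c <;> simp [duality] at hc ⊢

theorem diagramLE_of_level_of_duality {c d : ListIndex} (hl : d.level ≤ c.level)
    (hd : d.duality ≤ c.duality) : DiagramLE c d := by
  have key : ∀ c d : ListIndex, c.duality ≤ 1 → d.level ≤ c.level → d.duality ≤ c.duality →
      DiagramLE c d := by
    intro c d hc hl hd
    rcases (show c.duality = 0 ∨ c.duality = 1 by omega) with h | h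
    · exact diagramLE_of_duality_eq_zero h (by omega) hl
    · rcases (show d.duality = 0 ∨ d.duality = 1 by omega) with h' | h'
      · obtain ⟨b, hb, hb0, hbl⟩ := exists_edge_of_duality_eq_one h
        exact hb.diagramLE.trans (diagramLE_of_duality_eq_zero hb0 h' (hbl ▸ hl))
      · exact diagramLE_of_duality_eq_one h h' hl
  by_cases hc : c.duality ≤ 1
  · exact key c d hc hl hd
  · obtain rfl := eq_Dinf_of_duality (c := c) (by omega)
    by_cases hd' : d.duality ≤ 1
    · exact Edge.Dinf_Cinf.diagramLE.trans (key Cinf d le_rfl hl hd')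
    · obtain rfl := eq_Dinf_of_duality (c := d) (by omega)
      exact Relation.ReflTransGen.refl

theorem one_le_level {d : ListIndex} (h : d ≠ T) : 1 ≤ d.level := by
  rcases d with _ | k | k | k | k | _ | _ | _ <;> simp only [level, ne_eq, not_true_eq_false,
    Nat.one_le_cast, le_top] at h ⊢ <;> have := k.pos <;> omega

/-- If `c` has duality `0`, then `B_∞` lies below `c` and `d` lies below `D_1`. If it has duality
`1`, then `C_∞` lies below `c` and `d` is `D_∞`. Each case reduces to one excluded homomorphism. -/
theorem duality_le_of_homLE {c d : ListIndex} (h : (listMinion c).HomLE (listMinion d)) :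
    d.duality ≤ c.duality := by
  by_contra! hlt
  by_cases hc : c.duality = 0
  · have h1 : DiagramLE Binf c := diagramLE_of_level_of_duality le_top hc.le
    have h2 : DiagramLE d (D 1) := diagramLE_of_level_of_duality
      (one_le_level (by rintro rfl; simp [duality] at hlt)) (show 1 ≤ _ by omega)
    exact not_minionBinf_le_minionD_one
      ((homLE_of_diagramLE h1).trans (h.trans (homLE_of_diagramLE h2)))
  · have hd : d.duality ≤ 2 := by cases d <;> simp [duality]
    obtain rfl := eq_Dinf_of_duality (c := d) (by omega)
    have h1 : DiagramLE Cinf c :=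
      diagramLE_of_level_of_duality le_top (show c.duality ≤ 1 by omega)
    exact not_minionCinf_le_minionDinf ((homLE_of_diagramLE h1).trans h)

/-- Among the entries of the level of `c`, if this is finite and positive, `D_k` or `C_{k+1}` lies
below `c`. Every entry of larger level lies below `B_k` or `A_{k+1}` respectively, so the excluded
homomorphisms between these suffice. -/
theorem level_le_of_homLE {c d : ListIndex} (h : (listMinion c).HomLE (listMinion d)) :
    d.level ≤ c.level := by
  by_contra! hlt
  have succ_le : ∀ n : ℕ, (n : ℕ∞) < d.level → ((n + 1 : ℕ) : ℕ∞) ≤ d.level := fun n hn => by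
    rw [Nat.cast_add, Nat.cast_one]
    exact Order.add_one_le_of_lt hn
  have hD : ∀ k : ℕ+, c.level = ((2 * k - 1 : ℕ) : ℕ∞) → (listMinion (D k)).HomLE (listMinion c) →
      False := by
    intro k hk hc
    have h1 : DiagramLE d (B k) := diagramLE_of_level_of_duality (by
      have h1 := succ_le _ (hk ▸ hlt)
      have h2 := k.pos
      rwa [show 2 * (k : ℕ) - 1 + 1 = 2 * k by omega] at h1) (Nat.zero_le _)
    exact not_minionD_le_minionB k (hc.trans (h.trans (homLE_of_diagramLE h1)))
  have hC : ∀ k : ℕ+, c.level = ((2 * k : ℕ) : ℕ∞) → (listMinion (C k)).HomLE (listMinion c) →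
      False := by
    intro k hk hc
    have h1 : DiagramLE d (A (k + 1)) := diagramLE_of_level_of_duality (by
      have h1 := succ_le _ (hk ▸ hlt)
      have h2 := k.pos
      rwa [show 2 * (k : ℕ) + 1 = 2 * ((k + 1 : ℕ+) : ℕ) - 1 by
        rw [PNat.add_coe, PNat.one_coe]; omega] at h1) (Nat.zero_le _)
    exact not_minionC_le_minionA k (hc.trans (h.trans (homLE_of_diagramLE h1)))
  rcases c with _ | k | k | k | k | _ | _ | _
  · have h1 : DiagramLE d (A 1) := diagramLE_of_level_of_duality
      (one_le_level (by rintro rfl; exact lt_irrefl _ hlt)) (Nat.zero_le _)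
    exact not_minionT_le_minionA_one (h.trans (homLE_of_diagramLE h1))
  · exact hD k rfl (minionD_le_minionA k)
  · exact hC k rfl (minionC_le_minionB k)
  · exact hC k rfl ⟨Minion.Hom.id _⟩
  · exact hD k rfl ⟨Minion.Hom.id _⟩
  all_goals exact not_top_lt hlt

theorem homLE_iff_diagramLE (c d : ListIndex) :
    (listMinion c).HomLE (listMinion d) ↔ DiagramLE c d :=
  ⟨fun h => diagramLE_of_level_of_duality (level_le_of_homLE h) (duality_le_of_homLE h),
    homLE_of_diagramLE⟩

theorem ListIndex.ext_of_level_of_duality {c d : ListIndex} (hl : c.level = d.level)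
    (hd : c.duality = d.duality) : c = d := by
  have key : ∀ {k l : ℕ+}, (k : ℕ) = l → k = l := fun h => PNat.eq h
  rcases c with _ | l | l | l | l | _ | _ | _ <;> rcases d with _ | k | k | k | k | _ | _ | _ <;>
    simp only [duality, level, Nat.cast_inj, zero_ne_one, one_ne_zero, OfNat.ofNat_ne_one,
      OfNat.one_ne_ofNat, OfNat.zero_ne_ofNat, OfNat.ofNat_ne_zero, ENat.natCast_ne_top,
      ENat.zero_ne_top, ENat.top_ne_natCast, ENat.top_ne_zero, Nat.cast_eq_zero,
      A.injEq, B.injEq, C.injEq, D.injEq] at hd hl ⊢ <;>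
    first
      | (have := l.pos; have := k.pos; first | (exfalso; omega) | exact key (by omega))
      | (have := k.pos; have hl' : ((0 : ℕ) : ℕ∞) = _ := hl; rw [Nat.cast_inj] at hl'; omega)
      | (have := l.pos; omega)

theorem listMinion_equivalent_iff {c d : ListIndex} :
    (listMinion c).Equivalent (listMinion d) ↔ c = d := by
  refine ⟨fun h => ListIndex.ext_of_level_of_duality ?_ ?_, ?_⟩
  · exact le_antisymm (level_le_of_homLE h.2) (level_le_of_homLE h.1)
  · exact le_antisymm (duality_le_of_homLE h.2) (duality_le_of_homLE h.1)
  · rintro rfl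
    exact ⟨⟨Minion.Hom.id _⟩, ⟨Minion.Hom.id _⟩⟩

end Order

/-! ### Minion cores -/

section Core

variable {K : ℕ} {X : FunctionMinion (boolSorts K) (boolSorts K)}

/-- Every value `f_i(a)` is the value at `(0, 1)` of a binary minor of `f`, so the binary part
determines an endomorphism. If its square is the identity there, it is its own inverse. -/
theorem isCore_of_involutive (h : ∀ (ξ : Minion.Hom X.toMinion X.toMinion)
    (x : X.toMinion.obj 2), ξ.app 2 (ξ.app 2 x) = x) : X.toMinion.IsCore := by
  intro ξ
  have key : ξ.comp ξ = Minion.Hom.id _ := by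
    refine Minion.Hom.ext (funext fun n => funext fun x => Subtype.ext ?_)
    funext i a
    let α : Fin n → Fin (2 : ℕ+) := fun t => if a t then (1 : Fin 2) else (0 : Fin 2)
    have ha : a = tuple01 ∘ α := by
      funext t
      simp only [α, Function.comp]
      cases a t <;> rfl
    have h1 := h ξ (X.toMinion.map α x)
    rw [ξ.app_map, ξ.app_map] at h1
    have h2 := congrFun (congrFun (congrArg Subtype.val h1) i) tuple01
    rw [ha]
    exact h2
  exact ⟨ξ, key, key⟩

variable {ξ : Minion.Hom X.toMinion X.toMinion} {p q p' q' : Fin K → Bool}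

theorem app_binOp_eq (hX : ∀ n, ∀ f ∈ X.ops n, f.Idempotent) (h : binOp p q ∈ X.ops 2)
    (h₁ : ∀ i, ImageValue ξ p q i ↔ p' i = true) (h₂ : ∀ i, ImageValue ξ q p i ↔ q' i = true) :
    (ξ.app 2 ⟨binOp p q, h⟩).1 = binOp p' q' := by
  refine op_two_ext (hX _ _ (ξ.app 2 _).2) (fun _ _ => bin_const _) (fun i => ?_) fun i => ?_
  · rw [binOp_tuple01, Bool.eq_iff_iff, ← h₁ i]
    exact ⟨fun hv => ⟨h, hv⟩, fun hv => hv.2⟩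
  · rw [binOp_tuple10, Bool.eq_iff_iff, ← h₂ i, app_binOp_tuple10 h (swap_mem h)]
    exact ⟨fun hv => ⟨_, hv⟩, fun hv => hv.2⟩

theorem isCore_of_imageValue_iff (hX : ∀ n, ∀ f ∈ X.ops n, f.Idempotent)
    (h : ∀ (ξ : Minion.Hom X.toMinion X.toMinion) (p q : Fin K → Bool), binOp p q ∈ X.ops 2 →
      ∀ i, ImageValue ξ p q i ↔ p i = true) : X.toMinion.IsCore := by
  refine isCore_of_involutive fun ξ x => ?_
  have key : ∀ x : X.toMinion.obj 2, ξ.app 2 x = x := by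
    rintro ⟨f, hf⟩
    obtain ⟨p, q, rfl⟩ : ∃ p q, f = binOp p q := ⟨_, _, eq_binOp (hX _ _ hf)⟩
    exact Subtype.ext (app_binOp_eq hX hf (h ξ p q hf) (h ξ q p (swap_mem hf)))
  rw [key, key]

/-- Only the self-dual component `m` can change. It is forced when the component `l` is `1` at `(0,
1)` or `(1, 0)`; otherwise all components other than `m` vanish at both tuples, and changing `m`
exchanges the two arguments. In either case applying the endomorphism twice restores the operation.
-/
theorem isCore_of_imageValue_iff_of_ne (hX : ∀ n, ∀ f ∈ X.ops n, f.Idempotent) {l m : Fin K}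
    (hlm : l ≠ m) (hm : ∀ z ∈ X.ops 2, z m = dual (z m)) (hle : ∀ z ∈ X.ops 2, z l ≤ z m)
    (hl : ∀ z ∈ X.ops 2, ∀ i, i ≠ m → z i ≤ z l)
    (h : ∀ (ξ : Minion.Hom X.toMinion X.toMinion) (p q : Fin K → Bool), binOp p q ∈ X.ops 2 →
      ∀ i, i ≠ m → (ImageValue ξ p q i ↔ p i = true)) : X.toMinion.IsCore := by
  refine isCore_of_involutive fun ξ x => ?_
  obtain ⟨f, hf⟩ := x
  obtain ⟨p, q, rfl⟩ : ∃ p q, f = binOp p q := ⟨_, _, eq_binOp (hX _ _ hf)⟩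
  have hm' : ∀ p q, binOp p q ∈ X.ops 2 → (q m = true ↔ ¬ p m = true) := by
    intro p q hpq
    have := congrFun (hm _ hpq) tuple01
    rw [dual_tuple01, binOp_tuple01, binOp_tuple10] at this
    rw [this]
    simp
  have hmono : ∀ p q, binOp p q ∈ X.ops 2 → ∀ i j, (∀ z ∈ X.ops 2, z i ≤ z j) → p i = true →
      p j = true := by
    intro p q hpq i j hij
    have := hij _ hpq tuple01
    rw [binOp_tuple01, binOp_tuple01] at this
    exact this
  have hsm := fun p q hpq => imageValue_swap_iff (ξ := ξ) (p := p) (q := q) hpq hm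
  have hcase : ∀ p q, binOp p q ∈ X.ops 2 → p l = true → (ImageValue ξ p q m ↔ p m = true) := by
    intro p q hpq hpl
    exact ⟨fun _ => hmono p q hpq l m hle hpl, fun _ => ((h ξ p q hpq l hlm).2 hpl).mono hle⟩
  have hqp := swap_mem hf
  by_cases hpm : ImageValue ξ p q m ↔ p m = true
  · have hall : ∀ i, ImageValue ξ p q i ↔ p i = true := fun i => by
      by_cases hi : i = m
      · rwa [hi]
      · exact h ξ p q hf i hi
    have hall' : ∀ i, ImageValue ξ q p i ↔ q i = true := fun i => by
      by_cases hi : i = m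
      · rw [hi, hsm p q hf, hm' p q hf, hpm]
      · exact h ξ q p hqp i hi
    have hfix : ξ.app 2 ⟨binOp p q, hf⟩ = ⟨binOp p q, hf⟩ :=
      Subtype.ext (app_binOp_eq hX hf hall hall')
    rw [hfix, hfix]
  · have hpl : ¬ p l = true := fun hpl => hpm (hcase p q hf hpl)
    have hql : ¬ q l = true := fun hql => hpm (by
      have := hcase q p hqp hql
      rw [hsm p q hf, hm' p q hf] at this
      exact not_iff_not.1 this)
    have hflip : ∀ p q, binOp p q ∈ X.ops 2 → ¬ p l = true → ¬ q l = true →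
        ¬ (ImageValue ξ p q m ↔ p m = true) → ∀ i, ImageValue ξ p q i ↔ q i = true := by
      intro p q hpq hpl hql hpm i
      by_cases hi : i = m
      · rw [hi, hm' p q hpq]
        tauto
      · rw [h ξ p q hpq i hi]
        exact iff_of_false (fun hpi => hpl (hmono p q hpq i l (fun z hz => hl z hz i hi) hpi))
          fun hqi => hql (hmono q p (swap_mem hpq) i l (fun z hz => hl z hz i hi) hqi)
    have hpm' : ¬ (ImageValue ξ q p m ↔ q m = true) := by
      rw [hsm p q hf, hm' p q hf]
      tauto
    have e1 : ξ.app 2 ⟨binOp p q, hf⟩ = ⟨binOp q p, hqp⟩ :=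
      Subtype.ext (app_binOp_eq hX hf (hflip p q hf hpl hql hpm) (hflip q p hqp hql hpl hpm'))
    have e2 : ξ.app 2 ⟨binOp q p, hqp⟩ = ⟨binOp p q, hf⟩ :=
      Subtype.ext (app_binOp_eq hX hqp (hflip q p hqp hql hpl hpm') (hflip p q hf hpl hql hpm))
    rw [e1, e2]

/-- A binary member with `p l = 1` is `binOp (upper j) zeros`, because the components increase up to
`l` and `hup` fixes the rest. The steps along the chain show that its image has every `1` that it
should. A superfluous `1` can be shifted up to `upper (k - 1)` at a sort before `l`, which `hlast`
excludes; if `p l = 0`, it contradicts `h ≤ dual h` at `l`, or `hzero`. -/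
theorem imageValue_iff {k : ℕ} (hk : 0 < k) (hkK : k ≤ K)
    (hX : ∀ n, ∀ f ∈ X.ops n, f.Idempotent)
    (hT : ∀ n, ∀ z ∈ X.ops n, ∀ i j : Fin K, (i : ℕ) + 1 = j → (j : ℕ) < k → Tri (z i) (z j))
    {l : Fin K} (hl : (l : ℕ) + 1 = k) (hd : ∀ z ∈ X.ops 2, z l ≤ dual (z l))
    (hstep : ∀ j < k - 1, ternOp (upper j) zeros (upper (j + 1)) zeros ∈ X.ops 3)
    (hlast : ∀ i : Fin K, (i : ℕ) + 1 < k → ¬ ImageValue ξ (upper (k - 1)) zeros i)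
    (hzero : ∀ p q, binOp p q ∈ X.ops 2 → p l = false → q l = false → ¬ ImageValue ξ p q l)
    (hup : ∀ p q, binOp p q ∈ X.ops 2 → p l = true → ∀ i, l ≤ i → p i = true ∧ q i = false)
    (hpq : binOp p q ∈ X.ops 2) (i : Fin K) (hi : (i : ℕ) < k) :
    ImageValue ξ p q i ↔ p i = true := by
  have hle : ∀ i j : Fin K, i ≤ j → (j : ℕ) < k → ∀ z ∈ X.ops 2, z i ≤ z j := by
    intro i j hij hj z hz
    rcases hij.lt_or_eq with h | rfl
    · exact (tri_of_lt (K := k) (hT 2 z hz) i j h hj).le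
    · exact le_rfl
  have hil : i ≤ l := Fin.le_def.2 (by omega)
  have hmono : ∀ p q, binOp p q ∈ X.ops 2 → ∀ i j : Fin K, i ≤ j → (j : ℕ) < k → p i = true →
      p j = true := by
    intro p q hpq i j hij hj
    have := hle i j hij hj _ hpq tuple01
    rw [binOp_tuple01, binOp_tuple01] at this
    exact this
  have hnormal : ∀ p q, binOp p q ∈ X.ops 2 → p l = true →
      ∃ j, j < k ∧ p = upper j ∧ q = zeros := by
    intro p q hpq hpl
    -- `j` is the first sort at which `p` is `1`.
    have hex : ∃ j, ∃ h : j < K, p ⟨j, h⟩ = true := ⟨l, l.2, hpl⟩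
    classical
    obtain ⟨hjK, hj⟩ := Nat.find_spec hex
    have hjl : Nat.find hex ≤ l := Nat.find_min' hex ⟨l.2, hpl⟩
    refine ⟨Nat.find hex, by omega, funext fun i => ?_, funext fun i => ?_⟩
    · rw [Bool.eq_iff_iff, upper, decide_eq_true_eq]
      refine ⟨fun h => Nat.find_min' hex ⟨i.2, h⟩, fun h => ?_⟩
      rcases le_total l i with hli | hli
      · exact (hup p q hpq hpl i hli).1
      · exact hmono p q hpq _ i (Fin.le_def.2 h) (by have := Fin.le_def.1 hli; omega) hj
    · rcases le_total l i with hli | hli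
      · exact (hup p q hpq hpl i hli).2
      · rw [zeros, Bool.eq_false_iff]
        intro hqi
        have h1 := hmono q p (swap_mem hpq) i l hli (by omega) hqi
        rw [(hup p q hpq hpl l le_rfl).2] at h1
        exact Bool.false_ne_true h1
  have hback : ∀ p q, binOp p q ∈ X.ops 2 → ∀ i : Fin K, (i : ℕ) < k → p i = true →
      ImageValue ξ p q i := by
    intro p q hpq i hi hpi
    have hil : i ≤ l := Fin.le_def.2 (by omega)
    obtain ⟨j, hj, rfl, rfl⟩ := hnormal p q hpq (hmono p q hpq i l hil (by omega) hpi)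
    have hji : j ≤ i := by simpa [upper] using hpi
    have h := imageValue_upper (ξ := ξ) hX hX (binOp_upper_zero_mem hX) (K := k) (hT 3) hstep
      ⟨j, by omega⟩ hj (Nat.le_sub_one_of_lt hj)
    exact h.mono (hle _ _ (Fin.le_def.2 hji) hi)
  refine ⟨fun h => ?_, hback p q hpq i hi⟩
  by_contra hpi
  have hVl : ImageValue ξ p q l := h.mono (hle i l hil (by omega))
  by_cases hpl : p l = true
  · obtain ⟨j, hj, rfl, rfl⟩ := hnormal p q hpq hpl
    have hji : ¬ j ≤ i := by simpa [upper] using hpi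
    have h' := h.upper_shift (K := k) (hT 3) hstep (k - 1 - j) (by omega)
      ⟨i + (k - 1 - j), by omega⟩ rfl (by simp; omega)
    rw [show j + (k - 1 - j) = k - 1 by omega] at h'
    exact hlast _ (by simp; omega) h'
  · by_cases hql : q l = true
    · exact hVl.not_swap hd (hback q p (swap_mem hpq) l (by omega) hql)
    · exact hzero p q hpq (by simpa using hpl) (by simpa using hql) hVl

theorem isCore_of_chain (hK : 0 < K) (hX : ∀ n, ∀ f ∈ X.ops n, f.Idempotent)
    (hT : ∀ n, ∀ z ∈ X.ops n, ∀ i j : Fin K, (i : ℕ) + 1 = j → Tri (z i) (z j))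
    (hd : ∀ z ∈ X.ops 2, ∀ l : Fin K, (l : ℕ) + 1 = K → z l ≤ dual (z l))
    (hstep : ∀ j < K - 1, ternOp (upper j) zeros (upper (j + 1)) zeros ∈ X.ops 3)
    (hlast : ∀ (ξ : Minion.Hom X.toMinion X.toMinion) (i : Fin K), (i : ℕ) + 1 < K →
      ¬ ImageValue ξ (upper (K - 1)) zeros i) : X.toMinion.IsCore := by
  refine isCore_of_imageValue_iff hX fun ξ p q hpq i => ?_
  let l : Fin K := ⟨K - 1, by omega⟩
  have hl : (l : ℕ) + 1 = K := by simp only [l]; omega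
  have hle : ∀ z ∈ X.ops 2, ∀ i : Fin K, z i ≤ z l := by
    intro z hz i
    rcases (show i ≤ l from Fin.le_def.2 (by omega)).lt_or_eq with h | rfl
    · exact (tri_of_lt (K := K) (fun i j h _ => hT 2 z hz i j h) i l h l.2).le
    · exact le_rfl
  refine imageValue_iff hK le_rfl hX (fun n z hz i j h _ => hT n z hz i j h) hl
    (fun z hz => hd z hz l hl) hstep (hlast ξ) (fun p q hpq hp hq h => ?_)
    (fun p q hpq hp i hi => ?_) hpq i i.2
  · have hnone : ∀ p q, binOp p q ∈ X.ops 2 → p l = false → p = zeros := by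
      intro p q hpq hp
      funext i
      have := hle _ hpq i tuple01
      rw [binOp_tuple01, binOp_tuple01, hp] at this
      exact Bool.eq_false_of_le_false this
    obtain rfl := hnone p q hpq hp
    obtain rfl := hnone q _ (swap_mem hpq) hq
    exact h.not_swap (fun z hz => hd z hz l hl) h
  · obtain rfl : i = l := le_antisymm (Fin.le_def.2 (by omega)) hi
    refine ⟨hp, ?_⟩
    have := hd _ hpq _ hl tuple01
    rw [dual_tuple01, binOp_tuple01, binOp_tuple10, hp] at this
    simpa using this rfl

/-- The ternary operation would carry a `1` at a sort before `l` to the swap `binOp r s`, and then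
up to `l`, where `binOp s r` already has the value `1`. -/
theorem not_imageValue_of_flip {k : ℕ} {l : Fin K}
    (hT : ∀ n, ∀ z ∈ X.ops n, ∀ i j : Fin K, (i : ℕ) + 1 = j → (j : ℕ) < k → Tri (z i) (z j))
    (hl : (l : ℕ) + 1 = k) (hd : ∀ z ∈ X.ops 2, z l ≤ dual (z l)) {p r s : Fin K → Bool}
    (hrs : ternOp p zeros r s ∈ X.ops 3) (hsr : ImageValue ξ s r l) (i : Fin K)
    (hi : (i : ℕ) + 1 < k) : ¬ ImageValue ξ p zeros i := by
  intro h
  have hle : ∀ z ∈ X.ops 2, z ⟨i + 1, by omega⟩ ≤ z l := by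
    intro z hz
    rcases (show (⟨i + 1, by omega⟩ : Fin K) ≤ l from Fin.le_def.2 (by simp; omega)).lt_or_eq
      with h | h
    · exact (tri_of_lt (K := k) (hT 2 z hz) _ _ h (by omega)).le
    · rw [h]
  exact hsr.not_swap hd
    ((h.step hrs fun z hz => hT 3 z hz i ⟨i + 1, by omega⟩ rfl hi).mono hle)

theorem isCore_minionA_or_minionD {k : ℕ+} {X : FunctionMinion (boolSorts k) (boolSorts k)}
    (hDX : ∀ n, ∀ f ∈ (minionD k).ops n, f ∈ X.ops n)
    (hXA : ∀ n, ∀ f ∈ X.ops n, f ∈ (minionA k).ops n) : X.toMinion.IsCore := by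
  have hk := k.pos
  have hT : ∀ n, ∀ z ∈ X.ops n, ∀ i j : Fin k, (i : ℕ) + 1 = j → Tri (z i) (z j) :=
    fun n z hz => (hXA n z hz).2.1
  have hX : ∀ n, ∀ f ∈ X.ops n, f.Idempotent := fun n f hf => (hXA n f hf).1
  have hstep : ∀ j < (k : ℕ) - 1, ternOp (upper j) zeros (upper (j + 1)) zeros ∈ X.ops 3 :=
    fun j hj => hDX _ _ (upper_step_mem_minionD j (by omega))
  refine isCore_of_chain hk hX hT (fun z hz l hl => (hXA 2 z hz).2.2 l hl) hstep
    fun ξ i hi => ?_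
  let l : Fin k := ⟨k - 1, by omega⟩
  have hl : (l : ℕ) + 1 = k := by simp only [l]; omega
  exact not_imageValue_of_flip (k := k) (l := l) (fun n z hz i j h _ => hT n z hz i j h) hl
    (fun z hz => (hXA 2 z hz).2.2 l hl) (hDX _ _ upper_flip_mem_minionD)
    (imageValue_upper hX hX (binOp_upper_zero_mem hX) (K := k)
      (fun z hz i j h _ => hT 3 z hz i j h) hstep l l.2 le_rfl) i hi

theorem isCore_minionB (k : ℕ+) : (minionB k).toMinion.IsCore := by
  have hk := k.pos
  have hd : ∀ z ∈ (minionB k).ops 2, ∀ l : Fin k, (l : ℕ) + 1 = k → z l ≤ dual (z l) :=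
    fun z hz l hl => (hz.2.2 l hl).le
  refine isCore_of_chain hk (fun n f hf => hf.1) (fun n z hz => hz.2.1) hd
    (fun j _ => upper_step_mem_minionB j) fun ξ i hi h => ?_
  -- This step removes the last sort as well: `upper k` is `zeros`. The resulting operation is
  -- symmetric, so a value `1` at the last sort contradicts `h ≤ dual h`.
  have h1 := h.step (upper_step_mem_minionB _) fun z hz => hz.2.1 i ⟨i + 1, by omega⟩ rfl
  have h2 : (upper ((k : ℕ) - 1 + 1) : Fin k → Bool) = zeros := by
    funext i
    have := i.2
    simp only [upper, zeros, decide_eq_false_iff_not]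
    omega
  rw [h2] at h1
  have hlt : ∀ z ∈ (minionB k).ops 2,
      z ⟨i + 1, by omega⟩ ≤ z ⟨k - 1, by omega⟩ := by
    intro z hz
    rcases (show (⟨i + 1, by omega⟩ : Fin k) ≤ ⟨k - 1, by omega⟩ from
      Fin.le_def.2 (by simp; omega)).lt_or_eq with h | h
    · exact (tri_of_lt (K := k) (fun i j h _ => hz.2.1 i j h) _ _ h (by simp)).le
    · rw [h]
  have h3 := h1.mono hlt
  exact h3.not_swap (fun z hz => hd z hz _ (by simp; omega)) h3

theorem isCore_minionC (k : ℕ+) : (minionC (k + 1)).toMinion.IsCore := by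
  have hk0 := k.pos
  have hk : ((k + 1 : ℕ+) : ℕ) = k + 1 := PNat.add_coe k 1
  let l : Fin (k + 1 : ℕ+) := ⟨k - 1, by omega⟩
  let m : Fin (k + 1 : ℕ+) := ⟨k, by omega⟩
  have hl : (l : ℕ) + 1 = k := by simp only [l]; omega
  have hm : (m : ℕ) = k := rfl
  have hX : ∀ n, ∀ f ∈ (minionC (k + 1)).ops n, f.Idempotent := fun n f hf => hf.1
  have hT : ∀ n, ∀ z ∈ (minionC (k + 1)).ops n, ∀ i j : Fin (k + 1 : ℕ+), (i : ℕ) + 1 = j →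
      (j : ℕ) < k → Tri (z i) (z j) := fun n z hz i j h hj => hz.2.1 i j h (by omega)
  have hTd : ∀ n, ∀ z ∈ (minionC (k + 1)).ops n, Tri (z l) (dual (z l)) := fun n z hz =>
    hz.2.2.2.2 l (by omega)
  have hself : ∀ n, ∀ z ∈ (minionC (k + 1)).ops n, z m = dual (z m) := fun n z hz =>
    hz.2.2.2.1 m (by omega)
  have hlm : ∀ n, ∀ z ∈ (minionC (k + 1)).ops n, z l ≤ z m := fun n z hz =>
    hz.2.2.1 l m (by omega) (by omega)
  have hle : ∀ z ∈ (minionC (k + 1)).ops 2, ∀ i, i ≠ m → z i ≤ z l := by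
    intro z hz i hi
    have hi' : (i : ℕ) ≠ k := fun h => hi (Fin.ext h)
    rcases (show i ≤ l from Fin.le_def.2 (by omega)).lt_or_eq with h | rfl
    · exact (tri_of_lt (K := k) (hT 2 z hz) i l h (by omega)).le
    · exact le_rfl
  have hne : l ≠ m := fun h => by
    have := congrArg Fin.val h
    omega
  refine isCore_of_imageValue_iff_of_ne hX hne (hself 2) (hlm 2) hle fun ξ p q hpq i hi => ?_
  have hi' : (i : ℕ) ≠ k := fun h => hi (Fin.ext h)
  have hstep : ∀ j < (k : ℕ) - 1,
      ternOp (upper j) zeros (upper (j + 1)) zeros ∈ (minionC (k + 1)).ops 3 :=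
    fun j hj => upper_step_mem_minionC j (by omega)
  have hd : ∀ z ∈ (minionC (k + 1)).ops 2, z l ≤ dual (z l) := fun z hz => (hTd 2 z hz).le
  have hval : ∀ p q, binOp p q ∈ (minionC (k + 1)).ops 2 → q m = !(p m) := by
    intro p q hpq
    have := congrFun (hself 2 _ hpq) tuple01
    rw [dual_tuple01, binOp_tuple01, binOp_tuple10] at this
    rw [this, Bool.not_not]
  have hpm : ∀ p q, binOp p q ∈ (minionC (k + 1)).ops 2 → p l = true → p m = true := by
    intro p q hpq hp
    have := hlm 2 _ hpq tuple01
    rw [binOp_tuple01, binOp_tuple01] at this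
    exact this hp
  refine imageValue_iff hk0 (by omega) hX hT hl hd hstep (fun i hi h => ?_)
    (fun p q hpq hp hq h => ?_) (fun p q hpq hp i hi => ?_) hpq i (by omega)
  · have hflip := upper_flip_mem_minionC (k := k) (k - 1) (Or.inl rfl)
    -- Here `upper k` is not `zeros`, since it still contains the self-dual sort `m`. The assumed
    -- value is used twice: stepped up to `l` it gives the value `1` for `binOp (upper k) zeros`,
    -- and through the flip the value `1` for its swap.
    have h1 := h.step (upper_step_mem_minionC (k - 1) (by omega))
      fun z hz => hT 3 z hz i ⟨i + 1, by omega⟩ rfl hi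
    rw [show (k : ℕ) - 1 + 1 = k by omega] at h1
    refine not_imageValue_of_flip hT hl hd hflip (h1.mono fun z hz => hle z hz _ ?_) i hi h
    intro h
    have := congrArg Fin.val h
    simp only [m] at this
    omega
  · have hnone : ∀ p q, binOp p q ∈ (minionC (k + 1)).ops 2 → p l = false → ∀ i, i ≠ m →
        p i = false := by
      intro p q hpq hp i hi
      have := hle _ hpq i hi tuple01
      rw [binOp_tuple01, binOp_tuple01, hp] at this
      exact Bool.eq_false_of_le_false this
    have hform : ∀ p q, binOp p q ∈ (minionC (k + 1)).ops 2 → p l = false →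
        (p m = true → p = upper k) ∧ (p m = false → p = zeros) := by
      intro p q hpq hp
      refine ⟨fun hm => funext fun i => ?_, fun hm => funext fun i => ?_⟩
      · by_cases hi : i = m
        · rw [hi, hm]
          simp [upper, m]
        · rw [hnone p q hpq hp i hi]
          have : (i : ℕ) ≠ k := fun h => hi (Fin.ext h)
          simp only [upper, Bool.false_eq, decide_eq_false_iff_not]
          omega
      · by_cases hi : i = m
        · rw [hi, hm]
          rfl
        · exact hnone p q hpq hp i hi
    have hv := hval p q hpq
    have hqp := swap_mem hpq
    -- Only the self-dual component distinguishes the arguments, so `p` and `q` are `upper k` and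
    -- `zeros` in some order. A flip leads to the swapped operation, and `h_k ◁ dual h_k` forbids
    -- the value `1` at `l`.
    cases hpm : p m
    · rw [hpm] at hv
      obtain rfl := (hform p q hpq hp).2 hpm
      obtain rfl := (hform q _ hqp hq).1 hv
      exact h.not_step lower_flip_mem_minionC (hTd 3) h
    · rw [hpm] at hv
      obtain rfl := (hform p q hpq hp).1 hpm
      obtain rfl := (hform q _ hqp hq).2 hv
      exact h.not_step (upper_flip_mem_minionC k (Or.inr rfl)) (hTd 3) h
  · by_cases him : i = m
    · rw [him, hval p q hpq, hpm p q hpq hp]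
      exact ⟨rfl, rfl⟩
    · have : (i : ℕ) ≠ k := fun h => him (Fin.ext h)
      obtain rfl : i = l := le_antisymm (Fin.le_def.2 (by omega)) hi
      refine ⟨hp, ?_⟩
      have := hd _ hpq tuple01
      rw [dual_tuple01, binOp_tuple01, binOp_tuple10, hp] at this
      simpa using this rfl

theorem isCore_minionBinf : minionBinf.toMinion.IsCore := by
  refine isCore_of_chain one_pos (fun n f hf => hf.1) (fun n z hz i j h => by omega)
    (fun z hz l hl => ?_) (fun j hj => by omega) fun ξ i hi => by omega
  obtain rfl : l = 0 := Subsingleton.elim _ _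
  exact hz.2.2.le

theorem isCore_minionDinf : minionDinf.toMinion.IsCore := by
  refine isCore_of_chain one_pos (fun n f hf => hf.1) (fun n z hz i j h => by omega)
    (fun z hz l hl => ?_) (fun j hj => by omega) fun ξ i hi => by omega
  obtain rfl : l = 0 := Subsingleton.elim _ _
  exact hz.2.2.le

theorem isCore_minionCinf : minionCinf.toMinion.IsCore := by
  have hTd : ∀ n, ∀ z ∈ minionCinf.ops n, Tri (z 0) (dual (z 0)) := fun n z hz =>
    hz.2.2.1.trans (hz.2.2.2 ▸ hz.2.2.1.dual)
  have hX : ∀ n, ∀ f ∈ minionCinf.ops n, f.Idempotent := fun n f hf => hf.1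
  have hne : ∀ i : Fin 2, i ≠ 1 → i = 0 := by decide
  refine isCore_of_imageValue_iff_of_ne hX (l := 0) (m := 1) (by decide)
    (fun z hz => hz.2.2.2) (fun z hz => hz.2.2.1.le) (fun z hz i hi => by rw [hne i hi])
    fun ξ p q hpq i hi => ?_
  obtain rfl := hne i hi
  have hval : ∀ p q, binOp p q ∈ minionCinf.ops 2 → q 1 = !(p 1) := by
    intro p q hpq
    have := congrFun hpq.2.2.2 tuple01
    rw [dual_tuple01, binOp_tuple01, binOp_tuple10] at this
    rw [this, Bool.not_not]
  have hform : ∀ (p : Fin 2 → Bool) (j : ℕ) , p 0 = decide (j ≤ 0) → p 1 = decide (j ≤ 1) →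
      p = upper j := fun p j h0 h1 => funext fun i => by
    fin_cases i
    · exact h0
    · exact h1
  have hform' : ∀ p : Fin 2 → Bool, p 0 = false → p 1 = false → p = zeros :=
    fun p h0 h1 => funext fun i => by
      fin_cases i
      · exact h0
      · exact h1
  refine imageValue_iff (k := 1) one_pos one_le_two hX (fun n z hz i j h hj => by omega)
    (l := 0) rfl (fun z hz => (hTd 2 z hz).le) (fun j hj => by omega) (fun i hi => by omega)
    (fun p q hpq hp hq h => ?_) (fun p q hpq hp i _ => ?_) hpq 0 one_pos
  · have hv := hval p q hpq
    cases hp1 : p 1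
    · obtain rfl := hform' p hp hp1
      obtain rfl := hform q 1 (by simpa using hq) (by rw [hv, hp1]; rfl)
      exact h.not_step lower_flip_mem_minionCinf (hTd 3) h
    · obtain rfl := hform p 1 (by simpa using hp) (by rw [hp1]; rfl)
      obtain rfl := hform' q hq (by rw [hv, hp1]; rfl)
      exact h.not_step upper_flip_mem_minionCinf (hTd 3) h
  · by_cases hi : i = 1
    · have h1 : p 1 = true := by
        have := hpq.2.2.1.le tuple01
        rw [binOp_tuple01, binOp_tuple01] at this
        exact this hp
      rw [hi, hval p q hpq, h1]
      exact ⟨rfl, rfl⟩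
    · obtain rfl := hne i hi
      refine ⟨hp, ?_⟩
      have := (hTd 2 _ hpq).le tuple01
      rw [dual_tuple01, binOp_tuple01, binOp_tuple10, hp] at this
      simpa using this rfl

theorem isCore_minionT : minionT.toMinion.IsCore := fun ξ =>
  have h : ∀ ζ ζ' : Minion.Hom minionT.toMinion minionT.toMinion, ζ = ζ' := fun _ _ =>
    Minion.Hom.ext (funext fun _ => funext fun _ => Subtype.ext (funext fun _ => funext fun _ => rfl))
  ⟨ξ, h _ _, h _ _⟩

theorem isCore_listMinion (c : ListIndex) : (listMinion c).IsCore := by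
  cases c with
  | T => exact isCore_minionT
  | A k =>
    exact isCore_minionA_or_minionD (X := minionA k)
      (fun n f hf => ⟨hf.1, hf.2.1, fun i hi => (hf.2.2 i hi).le⟩) fun n f hf => hf
  | B k => exact isCore_minionB k
  | C k => exact isCore_minionC k
  | D k =>
    exact isCore_minionA_or_minionD (X := minionD k) (fun n f hf => hf)
      fun n f hf => ⟨hf.1, hf.2.1, fun i hi => (hf.2.2 i hi).le⟩
  | Binf => exact isCore_minionBinf
  | Cinf => exact isCore_minionCinf
  | Dinf => exact isCore_minionDinf

end Core

end MultisortedBoolean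

theorem mainTheorem1 :
    (∀ (k : ℕ) (_ : 0 < k)
        (Γ : Set (MultisortedBoolean.SortedRelation (MultisortedBoolean.boolSorts k))),
        (∀ R ∈ Γ, R.arity ≤ 2) →
        ∃! c : MultisortedBoolean.ListIndex,
          (MultisortedBoolean.Pol Γ).toMinion.Equivalent (MultisortedBoolean.listMinion c)) ∧
    (∀ c : MultisortedBoolean.ListIndex, (MultisortedBoolean.listMinion c).IsCore) ∧
    (∀ c d : MultisortedBoolean.ListIndex,
        (MultisortedBoolean.listMinion c).HomLE (MultisortedBoolean.listMinion d) ↔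
          MultisortedBoolean.DiagramLE c d) ∧
    (∀ c : MultisortedBoolean.ListIndex, ∃ (k : ℕ) (_ : 0 < k)
        (Γ : Set (MultisortedBoolean.SortedRelation (MultisortedBoolean.boolSorts k))),
        (∀ R ∈ Γ, R.arity ≤ 2) ∧
        (MultisortedBoolean.listMinion c).Equivalent (MultisortedBoolean.Pol Γ).toMinion) := by
  refine ⟨fun k _ Γ hΓ => ?_, MultisortedBoolean.isCore_listMinion,
    MultisortedBoolean.homLE_iff_diagramLE, MultisortedBoolean.exists_equivalent_listMinion⟩
  obtain ⟨c, hc⟩ := MultisortedBoolean.exists_listMinion_equivalent_pol Γ hΓ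
  exact ⟨c, hc, fun d hd => MultisortedBoolean.listMinion_equivalent_iff.1 (hd.symm.trans hc)⟩
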